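/- Let $(X,d)$ be a metric space, and let $\mathrm{Bd}(X)$ be the space of all non-empty closed bounded subsets of $X$ with the Hausdorff metric $d_H(A,B)=\max\{\sup_{x\in B}d(x,A),\sup_{x\in A}d(x,B)\}$. Definitions. Let $(Y,\rho)$ be a metric space and $S\subseteq Y$. - For $\eta>0$, an $\eta$-chain of length $l$ linking $x$ and $y$ in $Y$ is a sequence $x=x_0,x_1,\dots,x_l=y$ of points of $Y$ with $\rho(x_{i-1},x_i)<\eta$ for all $1\le i\le l$; its diameter is that of the set $\{x_0,\dots,x_l\}$. - $Y$ is locally chain connected at $S$ if for every $x_0\in S$ and $\varepsilon>0$ there is $\delta>0$ such that for every $\eta>0$ and every $x\in S$ with $\rho(x,x_0)<\delta$ there is an $\eta$-chain in $Y$ of diameter $<\varepsilon$ linking $x_0$ and $x$. $Y$ is locally chain connected if it is so at $S=Y$. - $Y$ is uniformly locally chain equi-connected at $S$ if for every $\varepsilon>0$ there is $\delta>0$ such that for every $\eta>0$ there is $l\in\mathbb N$ such that any $x,y\in S$ with $\rho(x,y)<\delta$ are linked by an $\eta$-chain in $Y$ of diameter $<\varepsilon$ and length $\le l$. - $Y$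 is uniformly locally trace equi-connected at $S$ if there are $\varepsilon_0>0$ and a non-decreasing function $\omega:(0,\infty)\to(0,\infty)$ with $\lim_{t\to+0}\omega(t)=0$ such that for any $x,y\in S$ with $\rho(x,y)<\varepsilon_0$ and any countable dense subset $Q\supseteq\{0,\rho(x,y)\}$ of $[0,\rho(x,y)]$ there is a uniformly continuous $f:Q\to Y$ with $f(0)=x$, $f(\rho(x,y))=y$ and $\sup\{\rho(f(p),f(q)):p,q\in Q,\ |p-q|\le t\}\le\omega(t)$ for all $t>0$. - $Y$ is an ANR if for every metric space $M$ containing $Y$ isometrically as a closed subset there is a retraction $r:U\to Y$ defined on some open neighborhood $U$ of $Y$ in $M$. - $\mathcal D_0(X)$ is the family of all non-empty closed discrete at most countable subsets $D$ of $X$ that are totally bounded or uniformly discrete in $X$; the latter means that for some $\varepsilon>0$ every open ball of radius $\varepsilon$ in $X$ contains at most one point of $D$. Statement. The following conditions are equivalent: 1. $\mathrm{Bd}(X)$ is an ANR; 2. $\mathrm{Bd}(X)$ is locally path connected; 3. $\mathrm{Bd}(X)$ is locally chain connected; 4. $\mathrm{Bd}(X)$ is locally chain connected at $\mathrm{Bd}(X)\cap\mathcal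 D_0(X)$; 5. $X$ is uniformly locally chain equi-connected at each bounded subset of $X$; 6. $X$ is uniformly locally trace equi-connected at each bounded subset of $X$. -/

import Mathlib

open Set Filter Topology
open scoped ENNReal

universe u

/-! ### The hyperspace of non-empty closed bounded subsets -/

/-- `Bd X`: the non-empty closed bounded subsets of the metric space `X`. -/
@[ext]
structure Bd (X : Type u) [MetricSpace X] where
  carrier : Set X
  nonempty : carrier.Nonempty
  isClosed : IsClosed carrier
  isBounded : Bornology.IsBounded carrier

theorem Bd.hausdorffEDist_ne_top {X : Type u} [MetricSpace X] (A B : Bd X) :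
    Metric.hausdorffEDist A.carrier B.carrier ≠ ∞ :=
  Metric.hausdorffEDist_ne_top_of_nonempty_of_bounded A.nonempty B.nonempty
    A.isBounded B.isBounded

/-- `Bd X` carries the Hausdorff metric
`d_H(A, B) = max (sup_{x ∈ A} d(x, B)) (sup_{x ∈ B} d(x, A))` and its topology. -/
noncomputable instance Bd.instMetricSpace (X : Type u) [MetricSpace X] : MetricSpace (Bd X) where
  dist A B := Metric.hausdorffDist A.carrier B.carrier
  dist_self _ := Metric.hausdorffDist_self_zero
  dist_comm _ _ := Metric.hausdorffDist_comm
  dist_triangle A B _ := Metric.hausdorffDist_triangle (Bd.hausdorffEDist_ne_top A B)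
  eq_of_dist_eq_zero {A B} h := Bd.ext <|
    (A.isClosed.hausdorffDist_zero_iff_eq B.isClosed (Bd.hausdorffEDist_ne_top A B)).1 h

/-! ### Discrete subsets -/

/-- `D` is uniformly discrete in `Y`: for some `ε > 0` every open `ε`-ball of `Y` contains at most
one point of `D`. -/
def IsUniformlyDiscrete {Y : Type u} [MetricSpace Y] (D : Set Y) : Prop :=
  ∃ ε : ℝ, 0 < ε ∧ ∀ x : Y, (D ∩ Metric.ball x ε).Subsingleton

/-- The family `𝒟₀(Y)` of all non-empty closed discrete (in the subspace topology) subsets of `Y`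
that are at most countable and are totally bounded or uniformly discrete in `Y`. -/
def discreteZero (Y : Type u) [MetricSpace Y] : Set (Set Y) :=
  {D | D.Nonempty ∧ IsClosed D ∧ DiscreteTopology D ∧ D.Countable ∧
    (TotallyBounded D ∨ IsUniformlyDiscrete D)}

/-! ### Chains -/

/-- `c 0, …, c l` is an `η`-chain of length `l` linking `x` and `y`. -/
def IsEtaChain {Y : Type u} [MetricSpace Y] (η : ℝ) (x y : Y) (l : ℕ) (c : Fin (l + 1) → Y) :
    Prop :=
  c 0 = x ∧ c (Fin.last l) = y ∧ ∀ i : Fin l, dist (c i.castSucc) (c i.succ) < η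

/-- `Y` is locally chain connected at the subset `S`. -/
def IsLocallyChainConnectedAt (Y : Type u) [MetricSpace Y] (S : Set Y) : Prop :=
  ∀ x₀ ∈ S, ∀ ε : ℝ, 0 < ε → ∃ δ : ℝ, 0 < δ ∧ ∀ η : ℝ, 0 < η →
    ∀ x ∈ S ∩ Metric.ball x₀ δ, ∃ (l : ℕ) (c : Fin (l + 1) → Y),
      IsEtaChain η x₀ x l c ∧ Metric.diam (range c) < ε

/-- `Y` is locally chain connected. -/
def IsLocallyChainConnected (Y : Type u) [MetricSpace Y] : Prop :=
  IsLocallyChainConnectedAt Y univ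

/-- `Y` is uniformly locally chain equi-connected at the subset `S`; the chains run in `Y`, and
the bound `N` on their length depends on `ε`, `δ`, `η` only. -/
def IsUnifLocChainEquiConnectedAt (Y : Type u) [MetricSpace Y] (S : Set Y) : Prop :=
  ∀ ε : ℝ, 0 < ε → ∃ δ : ℝ, 0 < δ ∧ ∀ η : ℝ, 0 < η → ∃ N : ℕ,
    ∀ x ∈ S, ∀ y ∈ S, dist x y < δ → ∃ (l : ℕ) (c : Fin (l + 1) → Y),
      IsEtaChain η x y l c ∧ Metric.diam (range c) < ε ∧ l ≤ N

/-! ### Traces -/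

/-- The continuity modulus `ω_f(t) = sup {d(f a, f b) : d(a, b) ≤ t}`, possibly infinite. -/
noncomputable def contModulus {A B : Type*} [MetricSpace A] [MetricSpace B] (f : A → B) (t : ℝ) :
    ℝ≥0∞ :=
  ⨆ (a : A) (b : A) (_ : dist a b ≤ t), edist (f a) (f b)

/-- `ω` restricts to a non-decreasing function `(0, ∞) → (0, ∞)` with limit `0` at `0+`; the
values of `ω` outside `(0, ∞)` are never used. -/
def IsContModulus (ω : ℝ → ℝ) : Prop :=
  (∀ t, 0 < t → 0 < ω t) ∧ MonotoneOn ω (Ioi 0) ∧ Tendsto ω (𝓝[>] 0) (𝓝 0)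

/-- `Y` is uniformly locally trace equi-connected at the subset `S`. -/
def IsUnifLocTraceEquiConnectedAt (Y : Type u) [MetricSpace Y] (S : Set Y) : Prop :=
  ∃ ε₀ : ℝ, 0 < ε₀ ∧ ∃ ω : ℝ → ℝ, IsContModulus ω ∧
    ∀ x ∈ S, ∀ y ∈ S, dist x y < ε₀ →
      ∀ Q : Set ℝ, Q.Countable → Q ⊆ Icc 0 (dist x y) → Icc 0 (dist x y) ⊆ closure Q →
        ∀ (h0 : (0 : ℝ) ∈ Q) (h1 : dist x y ∈ Q),
          ∃ f : Q → Y, UniformContinuous f ∧ f ⟨0, h0⟩ = x ∧ f ⟨dist x y, h1⟩ = y ∧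
            ∀ t : ℝ, 0 < t → contModulus f t ≤ ENNReal.ofReal (ω t)

/-! ### Absolute neighborhood retracts -/

/-- `Y` is an absolute neighborhood retract (for metric spaces): whenever `Y` is isometrically
embedded as a closed subset of a metric space `M`, some open neighborhood of it in `M` retracts
onto it. -/
def IsANR (Y : Type u) [MetricSpace Y] : Prop :=
  ∀ (M : Type u) [MetricSpace M] (i : Y → M), Isometry i → IsClosed (range i) →
    ∃ U : Set M, IsOpen U ∧ ∃ hU : range i ⊆ U, ∃ r : U → Y, Continuous r ∧
      ∀ y : Y, r ⟨i y, hU (mem_range_self y)⟩ = y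

/-! ### Distances in the hyperspace -/

/-! The cycle of implications turns on two facts. A chain of sets yields chains of points that all
have the same length, so connectedness of the hyperspace forces uniformity in `X`. Conversely, the
closure of any bounded union of nonempty sets is a point of `Bd X`, so a path in `X` with holes,
defined only on a countable dense set of parameters, is enough to move sets continuously. This is
why `X` need not be complete.

An ANR embeds as a closed subset of a convex set in a normed space; it is therefore a retract of a
locally path connected open set, and subdivided paths give chains.

To descend to `X`, suppose that a bounded set is not equi-connected. The failing pairs are packed
into two close test sets: sequences have Cauchy or separated subsequences, and pairs that need ever
longer chains must spread apart. One length then serves all the pairs at once, a contradiction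
(`ChainsAtTestSets.exists_linked`, `ChainsAtTestSets.isUnifLocChainEquiConnectedAt`).

Chains become traces by refining each step by a finer chain at scales `(1 / 2) ^ m`
(`exists_gridSystem`). The refinements stabilise on a dense set of parameters, into which a
prescribed countable set is carried by a Lipschitz map (`exists_lipschitz_into_dense`).

Traces give a retraction (`TraceSystem.isANR`): a point `z` off the image, at distance `ρ` from it,
goes to the closure of the union of initial parts of traces between sets whose distance from `z` is
comparable to `ρ`. The lengths of these parts taper off continuously in `z`, so no trace enters or
leaves abruptly. -/

theorem Bd.exists_dist_lt {X : Type u} [MetricSpace X] {A B : Bd X} {r : ℝ} (h : dist A B < r)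
    {x : X} (hx : x ∈ A.carrier) : ∃ y ∈ B.carrier, dist x y < r :=
  Metric.exists_dist_lt_of_hausdorffDist_lt hx h (Bd.hausdorffEDist_ne_top A B)

theorem Bd.dist_le {X : Type u} [MetricSpace X] {A B : Bd X} {r : ℝ} (hr : 0 ≤ r)
    (h₁ : ∀ x ∈ A.carrier, ∃ y ∈ B.carrier, dist x y ≤ r)
    (h₂ : ∀ x ∈ B.carrier, ∃ y ∈ A.carrier, dist x y ≤ r) : dist A B ≤ r :=
  Metric.hausdorffDist_le_of_mem_dist hr h₁ h₂

/-! ### The Kuratowski embedding and the Wojdysławski theorem -/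

/-- The Kuratowski embedding of a pointed metric space into its bounded continuous functions. -/
noncomputable def kuratowskiMap {Y : Type u} [MetricSpace Y] (b y : Y) :
    BoundedContinuousFunction Y ℝ :=
  BoundedContinuousFunction.ofNormedAddCommGroup (fun z => dist z y - dist z b) (by fun_prop)
    (dist y b) fun z => by
      rw [Real.norm_eq_abs, dist_comm z y, dist_comm z b, dist_comm y b]
      simpa [dist_comm] using abs_dist_sub_le y b z

theorem kuratowskiMap_apply {Y : Type u} [MetricSpace Y] (b y z : Y) :
    kuratowskiMap b y z = dist z y - dist z b := rfl

theorem isometry_kuratowskiMap {Y : Type u} [MetricSpace Y] (b : Y) :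
    Isometry (kuratowskiMap b) := by
  refine Isometry.of_dist_eq fun x y => le_antisymm ?_ ?_
  · refine (BoundedContinuousFunction.dist_le dist_nonneg).2 fun z => ?_
    rw [kuratowskiMap_apply, kuratowskiMap_apply, Real.dist_eq, sub_sub_sub_cancel_right,
      dist_comm z x, dist_comm z y]
    exact abs_dist_sub_le x y z
  · have h := BoundedContinuousFunction.dist_coe_le_dist (f := kuratowskiMap b x)
      (g := kuratowskiMap b y) y
    rw [kuratowskiMap_apply, kuratowskiMap_apply, Real.dist_eq, sub_sub_sub_cancel_right,
      dist_self, sub_zero, abs_of_nonneg dist_nonneg, dist_comm] at h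
    exact h

/-- At the point `k`, the difference of the images of `y` and `k` equals `dist k y`. Hence a convex
combination lies at distance at least `w j * dist k (y j)` from the image of `k`. Points whose
images approach `f` thus converge to any `y j` of positive weight, and `f` is its image. -/
theorem mem_range_kuratowskiMap_of_mem_closure {Y : Type u} [MetricSpace Y] (b : Y)
    {f : BoundedContinuousFunction Y ℝ} (hf : f ∈ convexHull ℝ (range (kuratowskiMap b)))
    (hc : f ∈ closure (range (kuratowskiMap b))) : f ∈ range (kuratowskiMap b) := by
  obtain ⟨ι, _, w, e, hw0, hw1, he, rfl⟩ := mem_convexHull_iff_exists_fintype.1 hf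
  choose y hy using he
  obtain ⟨j, hj⟩ : ∃ j, 0 < w j := by
    by_contra! h
    have : ∑ i, w i ≤ 0 := Finset.sum_nonpos fun i _ => h i
    linarith
  refine ⟨y j, ?_⟩
  have key : ∀ k, w j * dist k (y j) ≤ dist (∑ i, w i • e i) (kuratowskiMap b k) := by
    intro k
    have h := BoundedContinuousFunction.dist_coe_le_dist (f := ∑ i, w i • e i)
      (g := kuratowskiMap b k) k
    have h2 : (∑ i, w i • e i) k = ∑ i, w i * dist k (y i) - dist k b := by
      simp only [BoundedContinuousFunction.coe_sum, Finset.sum_apply,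
        BoundedContinuousFunction.coe_smul, smul_eq_mul, ← hy, kuratowskiMap_apply, mul_sub,
        Finset.sum_sub_distrib]
      rw [← Finset.sum_mul, hw1, one_mul]
    rw [h2, kuratowskiMap_apply, Real.dist_eq, sub_sub_sub_cancel_right, dist_self, sub_zero] at h
    refine le_trans ?_ ((le_abs_self _).trans h)
    exact Finset.single_le_sum (f := fun i => w i * dist k (y i))
      (fun i _ => mul_nonneg (hw0 i) dist_nonneg) (Finset.mem_univ j)
  refine (eq_of_forall_dist_le fun ε hε => ?_)
  obtain ⟨k, hk⟩ := Metric.mem_closure_range_iff.1 hc (min (w j * (ε / 2)) (ε / 2)) (by positivity)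
  have h1 : w j * dist k (y j) < w j * (ε / 2) :=
    (key k).trans_lt (hk.trans_le (min_le_left _ _))
  have h2 : dist k (y j) < ε / 2 := lt_of_mul_lt_mul_left h1 hj.le
  have h3 : dist (kuratowskiMap b k) (kuratowskiMap b (y j)) < ε / 2 := by
    rwa [(isometry_kuratowskiMap b).dist_eq]
  have h4 := hk.trans_le (min_le_right _ _)
  have := dist_triangle_left (kuratowskiMap b (y j)) (∑ i, w i • e i) (kuratowskiMap b k)
  rw [dist_comm] at h4
  linarith

/-- Inside the convex hull of its Kuratowski image the space is closed. A retraction has a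
continuous section, so it is a quotient map, and these preserve local path connectedness. -/
theorem IsANR.locallyPathConnectedSpace {Y : Type u} [MetricSpace Y] (h : IsANR Y) :
    LocallyPathConnectedSpace Y := by
  rcases isEmpty_or_nonempty Y with hY | ⟨⟨b⟩⟩
  · exact ⟨fun y => (hY.false y).elim⟩
  let M := convexHull ℝ (range (kuratowskiMap b))
  let i : Y → M := fun y => ⟨kuratowskiMap b y, subset_convexHull _ _ (mem_range_self y)⟩
  have hi : Isometry i := isometry_kuratowskiMap b
  have hc : IsClosed (range i) := by
    refine isClosed_of_closure_subset fun f hf => ?_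
    have h1 : (f : BoundedContinuousFunction Y ℝ) ∈ closure (range (kuratowskiMap b)) := by
      have := map_mem_closure continuous_subtype_val hf (t := range (kuratowskiMap b))
      refine this ?_
      rintro _ ⟨y, rfl⟩
      exact ⟨y, rfl⟩
    obtain ⟨y, hy⟩ := mem_range_kuratowskiMap_of_mem_closure b f.2 h1
    exact ⟨y, Subtype.ext hy⟩
  obtain ⟨U, hU, hYU, r, hr, hri⟩ := h M i hi hc
  have : LocallyPathConnectedSpace M := (convex_convexHull ℝ _).locallyPathConnectedSpace
  have : LocallyPathConnectedSpace U := hU.locallyPathConnectedSpace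
  have hs : Continuous fun y => (⟨i y, hYU (mem_range_self y)⟩ : U) := hi.continuous.subtype_mk _
  have hq : IsQuotientMap r := IsQuotientMap.of_inverse hs hr hri
  exact hq.locallyPathConnectedSpace

/-! ### From paths to chains -/

theorem LocallyPathConnectedSpace.isLocallyChainConnected {Y : Type u} [MetricSpace Y]
    [LocallyPathConnectedSpace Y] : IsLocallyChainConnected Y := by
  intro x₀ _ ε hε
  obtain ⟨V, ⟨hV, hVp⟩, hVε⟩ :=
    (path_connected_basis x₀).mem_iff.1 (Metric.ball_mem_nhds x₀ (ε := ε / 3) (by positivity))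
  obtain ⟨δ, hδ, hδV⟩ := Metric.mem_nhds_iff.1 hV
  refine ⟨δ, hδ, fun η hη x hx => ?_⟩
  obtain ⟨γ, hγ⟩ := hVp.joinedIn x₀ (mem_of_mem_nhds hV) x (hδV hx.2)
  obtain ⟨τ, hτ, hγτ⟩ := Metric.uniformContinuous_iff.1
    (CompactSpace.uniformContinuous_of_continuous γ.continuous) η hη
  obtain ⟨l, hl⟩ := exists_nat_one_div_lt hτ
  have hl0 : (0 : ℝ) < (l + 1 : ℕ) := by positivity
  refine ⟨l + 1, fun k => γ ⟨k / (l + 1 : ℕ), ?_, ?_⟩, ⟨?_, ?_, fun k => ?_⟩, ?_⟩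
  · positivity
  · rw [div_le_one hl0]
    exact_mod_cast k.is_le
  · simp
  · simp only [Fin.val_last]
    convert γ.target using 2
    exact Subtype.ext (div_self hl0.ne')
  · refine hγτ ?_
    rw [Subtype.dist_eq, Real.dist_eq, ← sub_div]
    simp only [Fin.val_castSucc, Fin.val_succ]
    rw [abs_div, abs_of_pos hl0]
    push_cast at hl ⊢
    simpa using hl
  · have : Metric.diam (range fun k : Fin (l + 1 + 1) => γ ⟨k / (l + 1 : ℕ), by positivity, by
        rw [div_le_one hl0]; exact_mod_cast k.is_le⟩) ≤ 2 * (ε / 3) := by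
      refine (Metric.diam_mono ?_ Metric.isBounded_ball).trans
        (Metric.diam_ball (x := x₀) (by positivity))
      rintro _ ⟨k, rfl⟩
      exact hVε (hγ _)
    linarith

theorem IsLocallyChainConnectedAt.mono {Y : Type u} [MetricSpace Y] {S T : Set Y} (hST : S ⊆ T)
    (h : IsLocallyChainConnectedAt Y T) : IsLocallyChainConnectedAt Y S := fun x₀ hx₀ ε hε =>
  let ⟨δ, hδ, H⟩ := h x₀ (hST hx₀) ε hε
  ⟨δ, hδ, fun η hη x hx => H η hη x ⟨hST hx.1, hx.2⟩⟩

/-! ### Chains inside a set -/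

/-- `x` and `y` are linked by an `η`-chain of length `n` that runs in `s`. -/
def Linked {X : Type u} [MetricSpace X] (η : ℝ) (s : Set X) (n : ℕ) (x y : X) : Prop :=
  ∃ c : ℕ → X, c 0 = x ∧ c n = y ∧ (∀ i ≤ n, c i ∈ s) ∧ ∀ i < n, dist (c i) (c (i + 1)) < η

namespace Linked

variable {X : Type u} [MetricSpace X] {η η' : ℝ} {s t : Set X} {m n : ℕ} {x y z : X}

theorem zero_iff : Linked η s 0 x y ↔ x = y ∧ x ∈ s := by
  constructor
  · rintro ⟨c, rfl, rfl, h, -⟩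
    exact ⟨rfl, h 0 le_rfl⟩
  · rintro ⟨rfl, h⟩
    exact ⟨fun _ => x, rfl, rfl, fun _ _ => h, by simp⟩

theorem succ_iff : Linked η s (n + 1) x z ↔ ∃ y, Linked η s n x y ∧ dist y z < η ∧ z ∈ s := by
  constructor
  · rintro ⟨c, rfl, rfl, h, h'⟩
    exact ⟨c n, ⟨c, rfl, rfl, fun i hi => h i (by omega), fun i hi => h' i (by omega)⟩,
      h' n (by omega), h _ le_rfl⟩
  · rintro ⟨_, ⟨c, rfl, rfl, h, h'⟩, hd, hz⟩
    refine ⟨fun i => if i ≤ n then c i else z, by simp, by simp, fun i _ => ?_, fun i hi => ?_⟩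
    · dsimp only
      split_ifs with hi
      exacts [h i hi, hz]
    · rcases eq_or_lt_of_le (Nat.lt_succ_iff.1 hi) with rfl | hi
      · simpa using hd
      · simpa [hi.le, Nat.succ_le_of_lt hi] using h' i hi

theorem right_mem (h : Linked η s n x y) : y ∈ s := by
  obtain ⟨c, -, rfl, h, -⟩ := h
  exact h n le_rfl

theorem mono (hη : η ≤ η') (hs : s ⊆ t) (h : Linked η s n x y) : Linked η' t n x y := by
  obtain ⟨c, h0, hn, h, h'⟩ := h
  exact ⟨c, h0, hn, fun i hi => hs (h i hi), fun i hi => (h' i hi).trans_le hη⟩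

theorem single (hx : x ∈ s) (hy : y ∈ s) (h : dist x y < η) : Linked η s 1 x y :=
  succ_iff.2 ⟨x, zero_iff.2 ⟨rfl, hx⟩, h, hy⟩

theorem trans (h₁ : Linked η s m x y) (h₂ : Linked η s n y z) : Linked η s (m + n) x z := by
  induction n generalizing z with
  | zero =>
    obtain ⟨rfl, -⟩ := zero_iff.1 h₂
    exact h₁
  | succ n ih =>
    obtain ⟨w, hw, hd, hz⟩ := succ_iff.1 h₂
    exact succ_iff.2 ⟨w, ih hw, hd, hz⟩

theorem symm (h : Linked η s n x y) : Linked η s n y x := by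
  obtain ⟨c, rfl, rfl, h, h'⟩ := h
  refine ⟨fun i => c (n - i), by simp, by simp, fun i _ => h _ (Nat.sub_le _ _), fun i hi => ?_⟩
  have := h' (n - (i + 1)) (by omega)
  rw [dist_comm]
  convert this using 3
  omega

/-- The last point is repeated, so a bound on lengths may be read as an exact length. -/
theorem of_le (hη : 0 < η) (hmn : m ≤ n) (h : Linked η s m x y) : Linked η s n x y := by
  induction n, hmn using Nat.le_induction with
  | base => exact h
  | succ n _ ih => exact succ_iff.2 ⟨y, ih, by simpa using hη, h.right_mem⟩

/-- A chain of small steps near a separated set stays near one point of that set. -/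
theorem ball_of_separated {A : Set X} {ε γ : ℝ} (hA : A.Pairwise fun a b => γ ≤ dist a b)
    (hγ : 2 * ε + η ≤ γ) (hx : x ∈ A) (hε : 0 < ε) (h : Linked η (Metric.thickening ε A) n x y) :
    Linked η (Metric.ball x ε) n x y := by
  induction n generalizing y with
  | zero =>
    obtain ⟨rfl, -⟩ := zero_iff.1 h
    exact zero_iff.2 ⟨rfl, Metric.mem_ball_self hε⟩
  | succ n ih =>
    obtain ⟨w, hw, hd, hy⟩ := succ_iff.1 h
    have hw' := ih hw
    refine succ_iff.2 ⟨w, hw', hd, ?_⟩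
    obtain ⟨a, ha, hya⟩ := Metric.mem_thickening_iff.1 hy
    have hwx := Metric.mem_ball.1 hw'.right_mem
    by_cases hax : x = a
    · rw [hax]
      exact hya
    · have h1 := hA hx ha hax
      have h2 := dist_triangle4 x w y a
      rw [dist_comm w x] at hwx
      linarith

theorem exists_isEtaChain (h : Linked η s n x y) :
    ∃ c : Fin (n + 1) → X, IsEtaChain η x y n c ∧ range c ⊆ s := by
  obtain ⟨c, h0, hn, h, h'⟩ := h
  refine ⟨fun i => c i, ⟨by simpa using h0, by simpa using hn, fun i => ?_⟩, ?_⟩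
  · simpa using h' i i.2
  · rintro _ ⟨i, rfl⟩
    exact h i i.is_le

end Linked

theorem IsEtaChain.linked {X : Type u} [MetricSpace X] {η ε : ℝ} {x y : X} {n : ℕ}
    {c : Fin (n + 1) → X} (h : IsEtaChain η x y n c) (hd : Metric.diam (range c) < ε) :
    Linked η (Metric.ball x ε) n x y := by
  obtain ⟨rfl, rfl, h⟩ := h
  refine ⟨fun i => if hi : i < n + 1 then c ⟨i, hi⟩ else c 0, by simp, ?_, fun i hi => ?_,
    fun i hi => ?_⟩
  · simp [Fin.last]
  · simp only [Nat.lt_succ_of_le hi, dif_pos]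
    exact (Metric.dist_le_diam_of_mem (finite_range c).isBounded (mem_range_self _)
      (mem_range_self _)).trans_lt hd
  · have h1 : i < n + 1 := by omega
    have h2 : i + 1 < n + 1 := by omega
    simp only [h1, h2, dif_pos]
    exact h ⟨i, hi⟩

/-- Uniform local chain equi-connectedness in terms of chains that stay in balls. -/
theorem isUnifLocChainEquiConnectedAt_iff {X : Type u} [MetricSpace X] {S : Set X} :
    IsUnifLocChainEquiConnectedAt X S ↔ ∀ ε > 0, ∃ δ > 0, ∀ η > 0, ∃ N : ℕ, ∀ x ∈ S, ∀ y ∈ S,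
      dist x y < δ → Linked η (Metric.ball x ε) N x y := by
  constructor
  · intro h ε hε
    obtain ⟨δ, hδ, H⟩ := h ε hε
    refine ⟨δ, hδ, fun η hη => ?_⟩
    obtain ⟨N, hN⟩ := H η hη
    refine ⟨N, fun x hx y hy hxy => ?_⟩
    obtain ⟨l, c, hc, hd, hl⟩ := hN x hx y hy hxy
    exact (hc.linked hd).of_le hη hl
  · intro h ε hε
    obtain ⟨δ, hδ, H⟩ := h (ε / 3) (by positivity)
    refine ⟨δ, hδ, fun η hη => ?_⟩
    obtain ⟨N, hN⟩ := H η hη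
    refine ⟨N, fun x hx y hy hxy => ?_⟩
    obtain ⟨c, hc, hcs⟩ := (hN x hx y hy hxy).exists_isEtaChain
    refine ⟨N, c, hc, ?_, le_rfl⟩
    have h1 := (Metric.diam_mono hcs Metric.isBounded_ball).trans
      (Metric.diam_ball (x := x) (r := ε / 3) (by positivity))
    linarith

/-- A chain of sets lifts to chains of points. -/
theorem Linked.exists_mem {X : Type u} [MetricSpace X] {η : ℝ} {𝒮 : Set (Bd X)} {n : ℕ}
    {A B : Bd X} (h : Linked η 𝒮 n A B) {a : X} (ha : a ∈ A.carrier) :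
    ∃ b ∈ B.carrier, Linked η (⋃ C ∈ 𝒮, C.carrier) n a b := by
  induction n generalizing B with
  | zero =>
    obtain ⟨rfl, hA⟩ := Linked.zero_iff.1 h
    exact ⟨a, ha, Linked.zero_iff.2 ⟨rfl, mem_biUnion hA ha⟩⟩
  | succ n ih =>
    obtain ⟨C, hC, hd, hB⟩ := Linked.succ_iff.1 h
    obtain ⟨c, hc, hac⟩ := ih hC
    obtain ⟨b, hb, hcb⟩ := Bd.exists_dist_lt hd hc
    exact ⟨b, hb, Linked.succ_iff.2 ⟨c, hac, hcb, mem_biUnion hB hb⟩⟩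

/-! ### Discrete sets that serve as test points -/

/-- Every point has a ball that meets `D` in a finite set. -/
def HasNoAccPt {X : Type u} [MetricSpace X] (D : Set X) : Prop :=
  ∀ x, ∃ r > 0, (D ∩ Metric.ball x r).Finite

theorem HasNoAccPt.mono {X : Type u} [MetricSpace X] {D E : Set X} (h : HasNoAccPt D)
    (hE : E ⊆ D) : HasNoAccPt E := fun x =>
  let ⟨r, hr, H⟩ := h x
  ⟨r, hr, H.subset (inter_subset_inter_left _ hE)⟩

theorem HasNoAccPt.isClosed {X : Type u} [MetricSpace X] {D : Set X} (h : HasNoAccPt D) :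
    IsClosed D := by
  refine isClosed_of_closure_subset fun x hx => ?_
  obtain ⟨r, hr, H⟩ := h x
  have h1 : x ∈ closure (D ∩ Metric.ball x r) := by
    rw [Metric.mem_closure_iff] at hx ⊢
    intro ε hε
    obtain ⟨y, hy, hxy⟩ := hx (min ε r) (lt_min hε hr)
    refine ⟨y, ⟨hy, ?_⟩, hxy.trans_le (min_le_left _ _)⟩
    rw [Metric.mem_ball, dist_comm]
    exact hxy.trans_le (min_le_right _ _)
  rw [H.isClosed.closure_eq] at h1
  exact h1.1

theorem HasNoAccPt.discreteTopology {X : Type u} [MetricSpace X] {D : Set X} (h : HasNoAccPt D) :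
    DiscreteTopology D := by
  rw [discreteTopology_iff_forall_isClosed]
  intro t
  have := (h.mono (E := Subtype.val '' t) (by simp)).isClosed.preimage
    (continuous_subtype_val (p := (· ∈ D)))
  rwa [preimage_image_eq _ Subtype.val_injective] at this

/-- The distinct points of `D` have mutual distances bounded away from zero. -/
def IsSep {X : Type u} [MetricSpace X] (D : Set X) : Prop :=
  ∃ γ > 0, D.Pairwise fun a b => γ ≤ dist a b

theorem IsSep.inter_ball_subsingleton {X : Type u} [MetricSpace X] {D : Set X} (h : IsSep D) :
    ∃ r > 0, ∀ x, (D ∩ Metric.ball x r).Subsingleton := by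
  obtain ⟨γ, hγ, h⟩ := h
  refine ⟨γ / 2, by positivity, fun x a ha b hb => ?_⟩
  by_contra hab
  have h1 := h ha.1 hb.1 hab
  have h2 := dist_triangle_right a b x
  have h3 := Metric.mem_ball.1 ha.2
  have h4 := Metric.mem_ball.1 hb.2
  linarith

theorem IsSep.hasNoAccPt {X : Type u} [MetricSpace X] {D : Set X} (h : IsSep D) :
    HasNoAccPt D := fun x =>
  let ⟨r, hr, H⟩ := h.inter_ball_subsingleton
  ⟨r, hr, (H x).finite⟩

theorem IsSep.mono {X : Type u} [MetricSpace X] {D E : Set X} (h : IsSep D) (hE : E ⊆ D) :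
    IsSep E :=
  let ⟨γ, hγ, H⟩ := h
  ⟨γ, hγ, H.mono hE⟩

theorem IsSep.union {X : Type u} [MetricSpace X] {D E : Set X} (hD : IsSep D) (hE : IsSep E)
    {γ : ℝ} (hγ : 0 < γ) (h : ∀ d ∈ D, ∀ e ∈ E, γ ≤ dist d e) : IsSep (D ∪ E) := by
  obtain ⟨α, hα, hD⟩ := hD
  obtain ⟨β, hβ, hE⟩ := hE
  refine ⟨min γ (min α β), by positivity, ?_⟩
  rintro a (ha | ha) b (hb | hb) hab
  · exact ((min_le_right _ _).trans (min_le_left _ _)).trans (hD ha hb hab)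
  · exact (min_le_left _ _).trans (h a ha b hb)
  · rw [dist_comm]
    exact (min_le_left _ _).trans (h b hb a ha)
  · exact ((min_le_right _ _).trans (min_le_right _ _)).trans (hE ha hb hab)

theorem isSep_singleton {X : Type u} [MetricSpace X] (a : X) : IsSep {a} :=
  ⟨1, one_pos, pairwise_singleton _ _⟩

theorem IsSep.insert {X : Type u} [MetricSpace X] {D : Set X} (h : IsSep D) (a : X) :
    IsSep (insert a D) := by
  by_cases ha : a ∈ D
  · rwa [insert_eq_of_mem ha]
  · rcases D.eq_empty_or_nonempty with rfl | hne
    · simpa using isSep_singleton a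
    · refine (isSep_singleton a).union h
        ((h.hasNoAccPt.isClosed.notMem_iff_infDist_pos hne).1 ha) ?_
      rintro _ rfl e he
      exact Metric.infDist_le_dist_of_mem he

theorem IsSep.union_finite {X : Type u} [MetricSpace X] {D F : Set X} (h : IsSep D)
    (hF : F.Finite) : IsSep (F ∪ D) := by
  induction F, hF using Set.Finite.induction_on with
  | empty => simpa using h
  | insert _ _ ih =>
    rw [insert_union]
    exact ih.insert _

/-- The discrete sets at which the hyperspace is tested. -/
structure IsTestSet {X : Type u} [MetricSpace X] (D : Set X) : Prop where
  nonempty : D.Nonempty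
  isBounded : Bornology.IsBounded D
  countable : D.Countable
  hasNoAccPt : HasNoAccPt D
  small : TotallyBounded D ∨ IsSep D

theorem IsTestSet.mem_discreteZero {X : Type u} [MetricSpace X] {D : Set X} (h : IsTestSet D) :
    D ∈ discreteZero X :=
  ⟨h.nonempty, h.hasNoAccPt.isClosed, h.hasNoAccPt.discreteTopology, h.countable,
    h.small.imp_right IsSep.inter_ball_subsingleton⟩

theorem IsSep.isTestSet {X : Type u} [MetricSpace X] {D : Set X} (h : IsSep D) (hne : D.Nonempty)
    (hb : Bornology.IsBounded D) (hc : D.Countable) : IsTestSet D :=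
  ⟨hne, hb, hc, h.hasNoAccPt, Or.inr h⟩

/-- Local chain connectedness of the hyperspace at test sets, in terms of chains of points. -/
def ChainsAtTestSets (X : Type u) [MetricSpace X] : Prop :=
  ∀ A : Set X, IsTestSet A → ∀ ε > 0, ∃ δ > 0, ∀ η > 0, ∀ D : Set X, IsTestSet D →
    (∀ a ∈ A, ∃ d ∈ D, dist a d < δ) → (∀ d ∈ D, ∃ a ∈ A, dist d a < δ) →
      ∃ N, (∀ a ∈ A, ∃ d ∈ D, Linked η (Metric.thickening ε A) N a d) ∧
        ∀ d ∈ D, ∃ a ∈ A, Linked η (Metric.thickening ε A) N a d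

/-- Points follow the chain of sets forwards from `A` and backwards from `D`, so its length serves
all of them; sets within `ε` of `A` lie in its thickening. -/
theorem IsLocallyChainConnectedAt.chainsAtTestSets {X : Type u} [MetricSpace X]
    (h : IsLocallyChainConnectedAt (Bd X) {A : Bd X | A.carrier ∈ discreteZero X}) :
    ChainsAtTestSets X := by
  intro A hA ε hε
  let A' : Bd X := ⟨A, hA.nonempty, hA.hasNoAccPt.isClosed, hA.isBounded⟩
  obtain ⟨δ, hδ, H⟩ := h A' hA.mem_discreteZero ε hε
  refine ⟨δ / 2, by positivity, fun η hη D hD hAD hDA => ?_⟩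
  let D' : Bd X := ⟨D, hD.nonempty, hD.hasNoAccPt.isClosed, hD.isBounded⟩
  have hdist : dist D' A' < δ := by
    refine (Bd.dist_le (r := δ / 2) (by positivity) (fun x hx => ?_) fun x hx => ?_).trans_lt
      (by linarith)
    · obtain ⟨a, ha, h⟩ := hDA x hx
      exact ⟨a, ha, h.le⟩
    · obtain ⟨d, hd, h⟩ := hAD x hx
      exact ⟨d, hd, h.le⟩
  obtain ⟨N, c, hc, hdiam⟩ := H η hη D' ⟨hD.mem_discreteZero, hdist⟩
  have hl := hc.linked hdiam
  have hsub : (⋃ C ∈ Metric.ball A' ε, C.carrier) ⊆ Metric.thickening ε A := by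
    intro x hx
    obtain ⟨C, hC, hxC⟩ := mem_iUnion₂.1 hx
    obtain ⟨a, ha, hxa⟩ := Bd.exists_dist_lt (Metric.mem_ball.1 hC) hxC
    exact Metric.mem_thickening_iff.2 ⟨a, ha, hxa⟩
  refine ⟨N, fun a ha => ?_, fun d hd => ?_⟩
  · obtain ⟨d, hd, h⟩ := hl.exists_mem (a := a) ha
    exact ⟨d, hd, h.mono le_rfl hsub⟩
  · obtain ⟨a, ha, h⟩ := hl.symm.exists_mem (a := d) hd
    exact ⟨a, ha, (h.mono le_rfl hsub).symm⟩

/-! ### Selecting subsequences -/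

/-- Choosing a sequence term by term, each term subject to a condition on the earlier ones. -/
theorem exists_seq_forall_fin {α : Type*} (R : (n : ℕ) → (Fin n → α) → α → Prop)
    (h : ∀ n v, ∃ a, R n v a) : ∃ f : ℕ → α, ∀ n, R n (fun i => f i) (f n) := by
  choose F hF using h
  refine ⟨fun n => Nat.strongRecOn n fun n ih => F n fun i => ih i i.2, fun n => ?_⟩
  beta_reduce
  conv => arg 3; rw [Nat.strongRecOn_eq]
  exact hF n _

/-- A separated selection from a sequence of sequences that leave every bounded neighbourhood of
the given size; each of the sequences is used infinitely often. -/
theorem exists_separated_selection {X : Type u} [MetricSpace X] {γ : ℝ} (u : ℕ → ℕ → X)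
    (h : ∀ n m l, ∃ K, ∀ k ≥ K, γ ≤ dist (u n k) (u m l)) :
    ∃ κ : ℕ → ℕ, (∀ i, i ≤ κ i) ∧
      ∀ i, ∀ j < i, γ ≤ dist (u i.unpair.1 (κ i)) (u j.unpair.1 (κ j)) := by
  choose K hK using h
  obtain ⟨κ, hκ⟩ := exists_seq_forall_fin (α := ℕ)
    (fun i v a => i ≤ a ∧ ∀ j : Fin i, γ ≤ dist (u i.unpair.1 a) (u (j : ℕ).unpair.1 (v j)))
    fun i v => ⟨i + ∑ j : Fin i, K i.unpair.1 (j : ℕ).unpair.1 (v j), by omega, fun j => hK _ _ _ _ <|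
      le_add_left (Finset.single_le_sum (f := fun j : Fin i => K i.unpair.1 (j : ℕ).unpair.1 (v j))
        (fun _ _ => Nat.zero_le _) (Finset.mem_univ j))⟩
  exact ⟨κ, fun i => (hκ i).1, fun i j hj => (hκ i).2 ⟨j, hj⟩⟩

/-- The closure of the range in the completion is compact. -/
theorem TotallyBounded.exists_cauchySeq_subseq {X : Type u} [MetricSpace X] {x : ℕ → X}
    (h : TotallyBounded (range x)) : ∃ φ : ℕ → ℕ, StrictMono φ ∧ CauchySeq (x ∘ φ) := by
  have h1 := (h.image (UniformSpace.Completion.uniformContinuous_coe X)).closure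
  obtain ⟨a, -, φ, hφ, ha⟩ := (h1.isCompact_of_isClosed isClosed_closure).tendsto_subseq
    (x := fun n => (x n : UniformSpace.Completion X))
    fun n => subset_closure (mem_image_of_mem _ (mem_range_self n))
  refine ⟨φ, hφ, ?_⟩
  have h2 := ha.cauchySeq
  rw [Metric.cauchySeq_iff] at h2 ⊢
  simpa [UniformSpace.Completion.dist_eq] using h2

theorem exists_cauchySeq_or_separated_subseq {X : Type u} [MetricSpace X] (x : ℕ → X) :
    (∃ φ : ℕ → ℕ, StrictMono φ ∧ CauchySeq (x ∘ φ)) ∨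
      ∃ γ > 0, ∃ φ : ℕ → ℕ, StrictMono φ ∧ ∀ i j, i < j → γ ≤ dist (x (φ i)) (x (φ j)) := by
  by_cases h : TotallyBounded (range x)
  · exact Or.inl h.exists_cauchySeq_subseq
  · right
    rw [Metric.totallyBounded_iff] at h
    push Not at h
    obtain ⟨γ, hγ, h⟩ := h
    obtain ⟨φ, -, hφ⟩ := exists_seq_of_forall_finset_exists (fun _ : ℕ => True)
      (fun i j => i < j ∧ γ ≤ dist (x i) (x j)) fun s _ => by
        -- The balls are centred at all terms up to the largest chosen index, so a term outside them
        -- automatically has a larger index.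
        obtain ⟨y, ⟨k, rfl⟩, hk⟩ := not_subset.1 (h (x '' Iic (s.sup id)) ((finite_Iic _).image _))
        simp only [mem_iUnion, not_exists, forall_mem_image, Metric.mem_ball, not_lt, mem_Iic] at hk
        refine ⟨k, trivial, fun i hi => ⟨?_, ?_⟩⟩
        · by_contra! hki
          have := hk (hki.trans (Finset.le_sup (f := id) hi))
          rw [dist_self] at this
          linarith
        · rw [dist_comm]
          exact hk (Finset.le_sup (f := id) hi)
    exact ⟨γ, hγ, φ, fun i j hij => (hφ i j hij).1, fun i j hij => (hφ i j hij).2⟩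

theorem CauchySeq.hasNoAccPt_range {X : Type u} [MetricSpace X] {x : ℕ → X} (h : CauchySeq x)
    (hx : ∀ p, ¬ Tendsto x atTop (𝓝 p)) : HasNoAccPt (range x) := by
  intro p
  have hp := hx p
  rw [Metric.tendsto_atTop] at hp
  push Not at hp
  obtain ⟨ε, hε, hp⟩ := hp
  obtain ⟨N, hN⟩ := Metric.cauchySeq_iff.1 h (ε / 2) (by positivity)
  obtain ⟨n, hn, hnp⟩ := hp N
  refine ⟨ε / 2, by positivity, ((finite_Iio N).image x).subset ?_⟩
  rintro _ ⟨⟨m, rfl⟩, hm⟩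
  refine mem_image_of_mem x ?_
  by_contra hmN
  have h1 := hN n hn m (not_lt.1 hmN)
  have h2 := dist_triangle (x n) (x m) p
  have h3 := Metric.mem_ball.1 hm
  linarith

theorem isSep_range_of_forall_lt {X : Type u} [MetricSpace X] {x : ℕ → X} {γ : ℝ} (hγ : 0 < γ)
    (h : ∀ i j, i < j → γ ≤ dist (x i) (x j)) :
    (range x).Pairwise (fun a b => γ ≤ dist a b) ∧ IsSep (range x) := by
  have : (range x).Pairwise fun a b => γ ≤ dist a b := by
    rintro _ ⟨i, rfl⟩ _ ⟨j, rfl⟩ hij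
    rcases lt_trichotomy i j with hlt | rfl | hlt
    · exact h i j hlt
    · exact absurd rfl hij
    · rw [dist_comm]
      exact h j i hlt
  exact ⟨this, γ, hγ, this⟩

/-! ### From the hyperspace to the base space -/

theorem ChainsAtTestSets.linked_of_separated {X : Type u} [MetricSpace X] (hX : ChainsAtTestSets X)
    {A : Set X} (hA : IsTestSet A) {γ : ℝ} (hγ : 0 < γ)
    (hAγ : A.Pairwise fun a b => γ ≤ dist a b) {ε : ℝ} (hε : 0 < ε) :
    ∃ δ > 0, ∀ η > 0, ∀ D : Set X, IsTestSet D → (∀ a ∈ A, ∃ d ∈ D, dist a d < δ) →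
      (∀ d ∈ D, ∃ a ∈ A, dist d a < δ) →
        ∃ N, ∀ d ∈ D, ∀ a ∈ A, dist a d < δ → Linked η (Metric.ball a ε) N a d := by
  -- With radius `γ / 8` and steps below `γ / 4` a chain cannot pass from one point of `A` to
  -- another, so it must start at the point of `A` that is near `d`.
  obtain ⟨δ, hδ, H⟩ := hX A hA (min ε (γ / 8)) (by positivity)
  refine ⟨min δ (γ / 8), by positivity, fun η hη D hD hAD hDA => ?_⟩
  obtain ⟨N, -, hN⟩ := H (min η (γ / 4)) (by positivity) D hD
    (fun a ha => (hAD a ha).imp fun d h => ⟨h.1, h.2.trans_le (min_le_left _ _)⟩)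
    (fun d hd => (hDA d hd).imp fun a h => ⟨h.1, h.2.trans_le (min_le_left _ _)⟩)
  refine ⟨N, fun d hd a ha had => ?_⟩
  obtain ⟨a', ha', h⟩ := hN d hd
  have h8 : min ε (γ / 8) ≤ γ / 8 := min_le_right _ _
  have h4 : min η (γ / 4) ≤ γ / 4 := min_le_right _ _
  have h' := h.ball_of_separated hAγ (by linarith) ha' (by positivity)
  obtain rfl : a = a' := by
    by_contra hne
    have h1 := hAγ ha ha' hne
    have h2 := dist_triangle a d a'
    have h3 := Metric.mem_ball.1 h'.right_mem
    have h5 := had.trans_le (min_le_right _ _)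
    linarith
  exact h'.mono (min_le_left _ _) (Metric.ball_subset_ball (min_le_left _ _))

/-- The sets to which a point is to be linked. -/
structure IsTarget {X : Type u} [MetricSpace X] (B Z : Set X) : Prop where
  nonempty : Z.Nonempty
  isSep : IsSep Z
  countable : Z.Countable
  subset : Z ⊆ B

/-- Exchanging the single point `x n` for the nearby set `Z n` leaves a separated set close to the
range of `x`. Since `δ` precedes `η`, the step size may depend on `n`. -/
theorem ChainsAtTestSets.exists_linked_of_separated {X : Type u} [MetricSpace X]
    (hX : ChainsAtTestSets X) {B : Set X} (hB : Bornology.IsBounded B) {ε : ℝ} (hε : 0 < ε)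
    {x : ℕ → X} (hx : ∀ n, x n ∈ B) {Z : ℕ → Set X} (hZ : ∀ n, IsTarget B (Z n))
    (hd : ∀ δ > 0, ∀ᶠ n in atTop, ∀ z ∈ Z n, dist (x n) z < δ) {η : ℕ → ℝ} (hη : ∀ n, 0 < η n)
    {γ : ℝ} (hγ : 0 < γ) (hxγ : ∀ i j, i < j → γ ≤ dist (x i) (x j)) :
    ∃ n N, ∀ z ∈ Z n, Linked (η n) (Metric.ball (x n) ε) N (x n) z := by
  obtain ⟨hsep, hsep'⟩ := isSep_range_of_forall_lt hγ hxγ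
  have hA : IsTestSet (range x) := hsep'.isTestSet (range_nonempty x)
    (hB.subset (range_subset_iff.2 hx)) (countable_range x)
  obtain ⟨δ, hδ, H⟩ := hX.linked_of_separated hA hγ hsep hε
  obtain ⟨n, hn⟩ := (hd (min δ (γ / 4)) (by positivity)).exists
  have hnδ : ∀ z ∈ Z n, dist (x n) z < δ := fun z hz => (hn z hz).trans_le (min_le_left _ _)
  have hD : IsTestSet (range x \ {x n} ∪ Z n) := by
    refine IsSep.isTestSet ((hsep'.mono sdiff_subset).union (hZ n).isSep (γ := γ / 2)
      (by positivity) ?_) ((hZ n).nonempty.inr) ?_ ?_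
    · rintro d ⟨hd, hdn⟩ z hz
      have h1 := hsep hd (mem_range_self n) hdn
      have h2 := (hn z hz).trans_le (min_le_right _ _)
      have h3 := dist_triangle_right d (x n) z
      linarith
    · exact (hB.subset (range_subset_iff.2 hx)).subset sdiff_subset |>.union (hB.subset (hZ n).subset)
    · exact ((countable_range x).mono sdiff_subset).union (hZ n).countable
  obtain ⟨z₀, hz₀⟩ := (hZ n).nonempty
  obtain ⟨N, hN⟩ := H (η n) (hη n) _ hD
    (fun a ha => by
      by_cases han : a = x n
      · exact ⟨z₀, Or.inr hz₀, han ▸ hnδ z₀ hz₀⟩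
      · exact ⟨a, Or.inl ⟨ha, han⟩, by simpa using hδ⟩)
    (fun d hd => by
      rcases hd with hd | hd
      · exact ⟨d, hd.1, by simpa using hδ⟩
      · exact ⟨x n, mem_range_self n, by simpa [dist_comm] using hnδ d hd⟩)
  exact ⟨n, N, fun z hz => hN z (Or.inr hz) (x n) (mem_range_self n) (hnδ z hz)⟩

/-- Both `{x n}` and `Z n` are close to `{p}`, so chains can be routed through the limit `p`. -/
theorem ChainsAtTestSets.exists_linked_of_tendsto {X : Type u} [MetricSpace X]
    (hX : ChainsAtTestSets X) {B : Set X} (hB : Bornology.IsBounded B) {ε : ℝ} (hε : 0 < ε)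
    {x : ℕ → X} {Z : ℕ → Set X} (hZ : ∀ n, IsTarget B (Z n))
    (hd : ∀ δ > 0, ∀ᶠ n in atTop, ∀ z ∈ Z n, dist (x n) z < δ) {η : ℕ → ℝ} (hη : ∀ n, 0 < η n)
    {p : X} (hp : Tendsto x atTop (𝓝 p)) :
    ∃ n N, ∀ z ∈ Z n, Linked (η n) (Metric.ball (x n) ε) N (x n) z := by
  have hsingle : ∀ a : X, IsTestSet {a} := fun a => (isSep_singleton a).isTestSet
    (singleton_nonempty a) Bornology.isBounded_singleton (countable_singleton a)
  obtain ⟨δ, hδ, H⟩ := hX {p} (hsingle p) (ε / 4) (by positivity)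
  obtain ⟨n, hn, hnp⟩ := ((hd (δ / 2) (by positivity)).and
    (Metric.tendsto_nhds.1 hp (min (δ / 2) (ε / 4)) (by positivity))).exists
  have hn1 : dist (x n) p < δ / 2 := hnp.trans_le (min_le_left _ _)
  have hn2 : dist (x n) p < ε / 4 := hnp.trans_le (min_le_right _ _)
  have hzp : ∀ z ∈ Z n, dist z p < δ := fun z hz => by
    have := dist_triangle_left z p (x n)
    linarith [hn z hz]
  obtain ⟨z₀, hz₀⟩ := (hZ n).nonempty
  obtain ⟨N₁, -, hN₁⟩ := H (η n) (hη n) (Z n) ((hZ n).isSep.isTestSet (hZ n).nonempty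
    (hB.subset (hZ n).subset) (hZ n).countable)
    (by simpa using ⟨z₀, hz₀, (dist_comm p z₀).trans_lt (hzp z₀ hz₀)⟩) (by simpa using hzp)
  obtain ⟨N₂, -, hN₂⟩ := H (η n) (hη n) {x n} (hsingle _)
    (by simpa [dist_comm p] using hn1.trans (half_lt_self hδ))
    (by simpa using hn1.trans (half_lt_self hδ))
  refine ⟨n, N₂ + N₁, fun z hz => ?_⟩
  obtain ⟨_, rfl, h₁⟩ := hN₁ z hz
  obtain ⟨_, rfl, h₂⟩ := hN₂ _ rfl
  refine (h₂.symm.trans h₁).mono le_rfl ?_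
  rw [Metric.thickening_singleton]
  refine Metric.ball_subset_ball' ?_
  rw [dist_comm]
  linarith

/-- The range is compared with an initial part of it joined with `Z m`. A chain to `z` may start at
any `x i`; the common point `p` serves to go from `x m` to that `x i`. -/
theorem ChainsAtTestSets.exists_linked_of_cauchySeq_of_linked {X : Type u} [MetricSpace X]
    (hX : ChainsAtTestSets X) {B : Set X} (hB : Bornology.IsBounded B)
    {x : ℕ → X} (hx : ∀ n, x n ∈ B) {Z : ℕ → Set X} (hZ : ∀ n, IsTarget B (Z n))
    (hd : ∀ δ > 0, ∀ᶠ n in atTop, ∀ z ∈ Z n, dist (x n) z < δ) {η : ℕ → ℝ} (hη : ∀ n, 0 < η n)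
    (hc : CauchySeq x) (ha : HasNoAccPt (range x)) {s : Set X} {ε : ℝ} (hε : 0 < ε)
    (hs : Metric.thickening ε (range x) ⊆ s) {p : X}
    (hp : ∀ n, ∀ η > 0, ∃ N, Linked η s N (x n) p) :
    ∃ n N, ∀ z ∈ Z n, Linked (η n) s N (x n) z := by
  have hxB : Bornology.IsBounded (range x) := hB.subset (range_subset_iff.2 hx)
  obtain ⟨δ, hδ, H⟩ := hX (range x)
    ⟨range_nonempty x, hxB, countable_range x, ha, Or.inl hc.totallyBounded_range⟩ ε hε
  obtain ⟨m₀, hm₀⟩ := Metric.cauchySeq_iff.1 hc δ hδ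
  obtain ⟨m, hm, hmm₀⟩ := ((hd δ hδ).and (eventually_ge_atTop m₀)).exists
  have hD : IsTestSet (x '' Iic m ∪ Z m) := by
    refine ((hZ m).isSep.union_finite ((finite_Iic m).image x)).isTestSet (hZ m).nonempty.inr ?_ ?_
    · exact (hxB.subset (image_subset_range _ _)).union (hB.subset (hZ m).subset)
    · exact ((finite_Iic m).image x).countable.union (hZ m).countable
  obtain ⟨N₀, -, hN₀⟩ := H (η m) (hη m) _ hD
    (by
      rintro _ ⟨n, rfl⟩
      rcases le_total n m with hnm | hnm
      · exact ⟨x n, Or.inl (mem_image_of_mem x hnm), by simpa using hδ⟩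
      · exact ⟨x m, Or.inl (mem_image_of_mem x (le_refl m)), hm₀ _ (hmm₀.trans hnm) _ hmm₀⟩)
    (by
      rintro d (⟨n, -, rfl⟩ | hdz)
      · exact ⟨x n, mem_range_self n, by simpa using hδ⟩
      · exact ⟨x m, mem_range_self m, by simpa [dist_comm] using hm d hdz⟩)
  have hsx : ∀ i, x i ∈ s := fun i =>
    hs (Metric.self_subset_thickening hε _ (mem_range_self i))
  -- The length is uniform in `i`: only finitely many terms precede `I`, and all later ones are one
  -- step away from `x I`.
  obtain ⟨N₁, hN₁⟩ : ∃ N₁, ∀ i, Linked (η m) s N₁ (x i) p := by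
    choose N hN using fun i => hp i (η m) (hη m)
    obtain ⟨I, hI⟩ := Metric.cauchySeq_iff.1 hc (η m) (hη m)
    refine ⟨1 + ∑ i ∈ Finset.range (I + 1), N i, fun i => ?_⟩
    have hle : ∀ j ≤ I, N j ≤ ∑ i ∈ Finset.range (I + 1), N i := fun j hj =>
      Finset.single_le_sum (f := N) (fun _ _ => Nat.zero_le _) (Finset.mem_range_succ_iff.2 hj)
    rcases le_total i I with h | h
    · exact (hN i).of_le (hη m) ((hle i h).trans (Nat.le_add_left _ _))
    · exact ((Linked.single (hsx i) (hsx I) (hI i h I le_rfl)).trans (hN I)).of_le (hη m)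
        (Nat.add_le_add_left (hle I le_rfl) 1)
  refine ⟨m, N₁ + (N₁ + N₀), fun z hz => ?_⟩
  obtain ⟨_, ⟨i, rfl⟩, hi⟩ := hN₀ z (Or.inr hz)
  exact (hN₁ m).trans ((hN₁ i).symm.trans (hi.mono le_rfl hs))

/-- A Cauchy sequence without a limit has infinitely many terms that are linked to one point by
arbitrarily fine chains. -/
theorem ChainsAtTestSets.exists_frequently_linked {X : Type u} [MetricSpace X]
    (hX : ChainsAtTestSets X) {x : ℕ → X} (hc : CauchySeq x) (ha : HasNoAccPt (range x))
    {ε : ℝ} (hε : 0 < ε) :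
    ∃ p, ∃ᶠ n in atTop, ∀ η > 0, ∃ N, Linked η (Metric.thickening ε (range x)) N (x n) p := by
  have hxB : Bornology.IsBounded (range x) := hc.totallyBounded_range.isBounded
  obtain ⟨δ, hδ, H⟩ := hX (range x)
    ⟨range_nonempty x, hxB, countable_range x, ha, Or.inl hc.totallyBounded_range⟩ ε hε
  obtain ⟨m, hm⟩ := Metric.cauchySeq_iff.1 hc δ hδ
  by_contra! hcon
  have h1 : ∀ᶠ n in atTop, ∀ j ∈ Iic m, ∃ η > 0, ∀ N,
      ¬ Linked η (Metric.thickening ε (range x)) N (x n) (x j) := by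
    refine (eventually_all_finite (finite_Iic m)).2 fun j _ => ?_
    simpa [not_frequently] using hcon (x j)
  obtain ⟨n, hn⟩ := h1.exists
  -- A failure at one step size persists at all smaller ones, so one `η` defeats the finitely many
  -- `j`. The finite set `x '' Iic m` is `δ`-close to the whole range, hence `x n` must nevertheless
  -- be linked to one of its points.
  have h2 : ∀ᶠ η in 𝓝[>] (0 : ℝ), ∀ j ∈ Iic m, ∀ N,
      ¬ Linked η (Metric.thickening ε (range x)) N (x n) (x j) := by
    refine (eventually_all_finite (finite_Iic m)).2 fun j hj => ?_
    obtain ⟨η₀, hη₀, h⟩ := hn j hj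
    filter_upwards [Ioo_mem_nhdsGT hη₀] with η hη N hN
    exact h N (hN.mono hη.2.le Subset.rfl)
  obtain ⟨η, hη, hη0⟩ := (h2.and self_mem_nhdsWithin).exists
  have hF : IsTestSet (x '' Iic m) := by
    have hf : (x '' Iic m).Finite := (finite_Iic m).image x
    have hs : IsSep (x '' Iic m) := by
      have : IsSep (∅ : Set X) := ⟨1, one_pos, pairwise_empty _⟩
      simpa using this.union_finite hf
    exact hs.isTestSet ⟨x m, mem_image_of_mem x (le_refl m)⟩ hf.isBounded hf.countable
  obtain ⟨N, hN, -⟩ := H η hη0 _ hF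
    (by
      rintro _ ⟨n, rfl⟩
      rcases le_total n m with hnm | hnm
      · exact ⟨x n, mem_image_of_mem x hnm, by simpa using hδ⟩
      · exact ⟨x m, mem_image_of_mem x (le_refl m), hm _ hnm _ le_rfl⟩)
    (by
      rintro _ ⟨n, -, rfl⟩
      exact ⟨x n, mem_range_self n, by simpa using hδ⟩)
  obtain ⟨_, ⟨j, hj, rfl⟩, h⟩ := hN (x n) (mem_range_self n)
  exact hη j hj N h

/-- This is the substitute for compactness: the targets cannot defeat uniform linking at every `n`.
A subsequence is separated, convergent, or Cauchy without a limit. In the last case a tail of small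
diameter is taken first, then its terms linked to a common point. -/
theorem ChainsAtTestSets.exists_linked {X : Type u} [MetricSpace X]
    (hX : ChainsAtTestSets X) {B : Set X} (hB : Bornology.IsBounded B) {ε : ℝ} (hε : 0 < ε)
    {x : ℕ → X} (hx : ∀ n, x n ∈ B) {Z : ℕ → Set X} (hZ : ∀ n, IsTarget B (Z n))
    (hd : ∀ δ > 0, ∀ᶠ n in atTop, ∀ z ∈ Z n, dist (x n) z < δ) {η : ℕ → ℝ}
    (hη : ∀ n, 0 < η n) :
    ∃ n N, ∀ z ∈ Z n, Linked (η n) (Metric.ball (x n) ε) N (x n) z := by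
  rcases exists_cauchySeq_or_separated_subseq x with ⟨φ, hφ, hc⟩ | ⟨γ, hγ, φ, hφ, hsep⟩
  · by_cases hp : ∃ p, Tendsto (x ∘ φ) atTop (𝓝 p)
    · obtain ⟨p, hp⟩ := hp
      obtain ⟨n, N, h⟩ := hX.exists_linked_of_tendsto hB hε (x := x ∘ φ) (Z := Z ∘ φ)
        (fun n => hZ _) (fun δ hδ => hφ.tendsto_atTop.eventually (hd δ hδ)) (η := η ∘ φ)
        (fun n => hη _) hp
      exact ⟨φ n, N, h⟩
    · push Not at hp
      obtain ⟨K, hK⟩ := Metric.cauchySeq_iff.1 hc (ε / 4) (by positivity)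
      have hK' : StrictMono fun n => φ (n + K) := fun a b hab => hφ (by omega)
      set y : ℕ → X := fun n => x (φ (n + K)) with hy
      have hyc : CauchySeq y := hc.comp_tendsto (tendsto_add_atTop_nat K)
      have hya : HasNoAccPt (range y) := (hc.hasNoAccPt_range hp).mono <| by
        rintro _ ⟨n, rfl⟩
        exact ⟨n + K, rfl⟩
      have hyb : ∀ n, Metric.thickening (ε / 4) (range y) ⊆ Metric.ball (y n) ε := by
        intro n w hw
        obtain ⟨_, ⟨j, rfl⟩, hj⟩ := Metric.mem_thickening_iff.1 hw
        have h1 : dist (y j) (y n) < ε / 4 := hK _ (Nat.le_add_left _ _) _ (Nat.le_add_left _ _)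
        have h2 := dist_triangle w (y j) (y n)
        rw [Metric.mem_ball]
        linarith
      obtain ⟨p, hp⟩ := hX.exists_frequently_linked hyc hya (ε := ε / 4) (by positivity)
      obtain ⟨ψ, hψ, hψp⟩ := extraction_of_frequently_atTop hp
      have hψK : StrictMono fun n => φ (ψ n + K) := hK'.comp hψ
      obtain ⟨n, N, h⟩ := hX.exists_linked_of_cauchySeq_of_linked hB (x := y ∘ ψ)
        (fun n => hx _) (Z := fun n => Z (φ (ψ n + K))) (fun n => hZ _)
        (fun δ hδ => hψK.tendsto_atTop.eventually (hd δ hδ)) (η := fun n => η (φ (ψ n + K)))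
        (fun n => hη _) (hyc.comp_tendsto hψ.tendsto_atTop) (hya.mono (range_comp_subset_range _ _))
        (by positivity : 0 < ε / 4)
        (Metric.thickening_subset_of_subset _ (range_comp_subset_range _ _)) hψp
      exact ⟨φ (ψ n + K), N, fun z hz => (h z hz).mono le_rfl (hyb _)⟩
  · obtain ⟨n, N, h⟩ := hX.exists_linked_of_separated hB hε (x := x ∘ φ) (fun n => hx _)
      (Z := Z ∘ φ) (fun n => hZ _) (fun δ hδ => hφ.tendsto_atTop.eventually (hd δ hδ))
      (η := η ∘ φ) (fun n => hη _) hγ hsep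
    exact ⟨φ n, N, h⟩

/-- Uniform linking without control of the length of the chains. -/
theorem ChainsAtTestSets.exists_delta_linked {X : Type u} [MetricSpace X]
    (hX : ChainsAtTestSets X) {B : Set X} (hB : Bornology.IsBounded B) {ε : ℝ} (hε : 0 < ε) :
    ∃ δ > 0, ∀ η > 0, ∀ x ∈ B, ∀ y ∈ B, dist x y < δ →
      ∃ N, Linked η (Metric.ball x ε) N x y := by
  by_contra! hcon
  choose η hη x hx y hy hxy hnot using fun n : ℕ => hcon (1 / ((n : ℝ) + 1)) (by positivity)
  obtain ⟨n, N, h⟩ := hX.exists_linked hB hε hx (Z := fun n => {y n})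
    (fun n => ⟨singleton_nonempty _, isSep_singleton _, countable_singleton _,
      singleton_subset_iff.2 (hy n)⟩)
    (fun δ hδ => by
      filter_upwards [tendsto_one_div_add_atTop_nhds_zero_nat.eventually (gt_mem_nhds hδ)] with n hn
      rintro _ rfl
      exact (hxy n).trans hn) hη
  exact hnot n N (h _ rfl)

/-- Uniform linking to one point by chains of bounded length. -/
theorem ChainsAtTestSets.exists_delta_linked_of_left {X : Type u} [MetricSpace X]
    (hX : ChainsAtTestSets X) {B : Set X} (hB : Bornology.IsBounded B) {ε : ℝ} (hε : 0 < ε) :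
    ∃ δ > 0, ∀ η > 0, ∀ x ∈ B, ∃ N, ∀ y ∈ B, dist x y < δ →
      Linked η (Metric.ball x ε) N x y := by
  obtain ⟨δ, hδ, H⟩ := hX.exists_delta_linked hB (ε := ε / 2) (by positivity)
  by_contra! hcon
  choose η hη x hx y hy hxy hnot using fun n : ℕ =>
    hcon (min (min δ (ε / 2)) (1 / ((n : ℝ) + 1))) (by positivity)
  have hyδ : ∀ n k, dist (x n) (y n k) < δ := fun n k =>
    (hxy n k).trans_le ((min_le_left _ _).trans (min_le_left _ _))
  have hyε : ∀ n k, dist (x n) (y n k) < ε / 2 := fun n k =>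
    (hxy n k).trans_le ((min_le_left _ _).trans (min_le_right _ _))
  -- If `y n k` came close to `y n l` for large `k`, one more step after a fixed chain to `y n l`
  -- would link it too cheaply. Hence the failing points of each level spread out and contain a
  -- separated target.
  have hfar : ∀ n l, ∃ K, ∀ k ≥ K, min (η n) (ε / 2) ≤ dist (y n k) (y n l) := by
    intro n l
    obtain ⟨N, hN⟩ := H (η n) (hη n) (x n) (hx n) (y n l) (hy n l) (hyδ n l)
    refine ⟨N + 1, fun k hk => ?_⟩
    by_contra! hlt
    refine hnot n k (Linked.of_le (hη n) hk (Linked.succ_iff.2 ⟨y n l,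
      hN.mono le_rfl (Metric.ball_subset_ball (by linarith)), ?_, ?_⟩))
    · rw [dist_comm]
      exact hlt.trans_le (min_le_left _ _)
    · rw [Metric.mem_ball, dist_comm]
      linarith [hyε n k]
  choose κ hκ hsep using fun n => exists_separated_selection (fun _ => y n) fun _ _ l => hfar n l
  obtain ⟨n, N, h⟩ := hX.exists_linked hB hε hx (Z := fun n => range fun i => y n (κ n i))
    (fun n => ⟨range_nonempty _, (isSep_range_of_forall_lt (γ := min (η n) (ε / 2))
        (lt_min (hη n) (by positivity)) fun i j hij => by
          rw [dist_comm]
          exact hsep n j i hij).2, countable_range _,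
      range_subset_iff.2 fun i => hy n _⟩)
    (fun δ hδ => by
      filter_upwards [tendsto_one_div_add_atTop_nhds_zero_nat.eventually (gt_mem_nhds hδ)] with n hn
      rintro _ ⟨i, rfl⟩
      exact ((hxy n _).trans_le (min_le_right _ _)).trans hn) hη
  exact hnot n (κ n N) ((h _ ⟨N, rfl⟩).of_le (hη n) (hκ n N))

/-- The closeness `δ'` is known only once `A` is fixed, and the failing level `m` only once `δ'` is
known. So `A` must contain infinitely many failing points of every level; `Nat.unpair` enumerates
the levels in this way. Replacing `x` by `y` on level `m` alone then gives a test set close to `A`.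
-/
theorem ChainsAtTestSets.isUnifLocChainEquiConnectedAt {X : Type u} [MetricSpace X]
    (hX : ChainsAtTestSets X) {B : Set X} (hB : Bornology.IsBounded B) :
    IsUnifLocChainEquiConnectedAt X B := by
  rw [isUnifLocChainEquiConnectedAt_iff]
  intro ε hε
  obtain ⟨δ, hδ, H⟩ := hX.exists_delta_linked_of_left hB (ε := ε / 3) (by positivity)
  by_contra! hcon
  set γ := min (δ / 2) (ε / 3) with hγ
  have hγ0 : 0 < γ := by positivity
  choose η hη x hx y hy hxy hnot using fun n : ℕ =>
    hcon (min γ (1 / ((n : ℝ) + 1))) (by positivity)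
  have hγδ : γ ≤ δ / 2 := min_le_left _ _
  have hγε : γ ≤ ε / 3 := min_le_right _ _
  -- If `x n k` is `γ`-close to `x m l`, so that `y n k` is `δ`-close to it, both are linked to it
  -- in `N` steps and hence to each other in `N + N`, which is impossible for `k ≥ N + N`.
  have hfar : ∀ n m l, ∃ K, ∀ k ≥ K, γ ≤ dist (x n k) (x m l) := by
    intro n m l
    obtain ⟨N, hN⟩ := H (η n) (hη n) (x m l) (hx m l)
    refine ⟨N + N, fun k hk => ?_⟩
    by_contra! hlt
    have h1 := (hxy n k).trans_le (min_le_left _ _)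
    have h2 := dist_triangle_left (x m l) (y n k) (x n k)
    have hNx := hN (x n k) (hx n k) (by rw [dist_comm]; linarith)
    have hNy := hN (y n k) (hy n k) (by linarith)
    refine hnot n k (((hNx.symm.trans hNy).of_le (hη n) hk).mono le_rfl
      (Metric.ball_subset_ball' ?_))
    rw [dist_comm]
    linarith
  obtain ⟨κ, hκ, hsep⟩ := exists_separated_selection x hfar
  set u : ℕ → X := fun i => x i.unpair.1 (κ i) with hu
  obtain ⟨hpair, hsep'⟩ := isSep_range_of_forall_lt (x := u) hγ0 fun i j hij => by
    rw [dist_comm]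
    exact hsep j i hij
  have hA : IsTestSet (range u) := hsep'.isTestSet (range_nonempty u)
    (hB.subset (range_subset_iff.2 fun i => hx _ _)) (countable_range u)
  obtain ⟨δ', hδ', H'⟩ := hX.linked_of_separated hA hγ0 hpair hε
  obtain ⟨m, hm⟩ := exists_nat_one_div_lt (lt_min hδ' (by positivity : 0 < γ / 4))
  set v : ℕ → X := fun i => if i.unpair.1 = m then y m (κ i) else u i with hv
  have huv : ∀ i, dist (u i) (v i) < min δ' (γ / 4) := by
    intro i
    simp only [hv]
    split_ifs with h
    · simp only [hu, h]
      exact ((hxy m _).trans_le (min_le_right _ _)).trans hm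
    · rw [dist_self]
      positivity
  have hD : IsTestSet (range v) := by
    refine (isSep_range_of_forall_lt (γ := γ / 2) (by positivity) fun i j hij => ?_).2.isTestSet
      (range_nonempty v) (hB.subset (range_subset_iff.2 fun i => ?_)) (countable_range v)
    · have h1 := (huv i).trans_le (min_le_right _ _)
      have h2 := (huv j).trans_le (min_le_right _ _)
      have h3 := hsep j i hij
      have h4 := dist_triangle4 (u i) (v i) (v j) (u j)
      rw [dist_comm (v j)] at h4
      have h5 : γ ≤ dist (u i) (u j) := by
        rw [dist_comm]
        exact h3
      linarith
    · simp only [hv]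
      split_ifs with h
      · exact hy _ _
      · exact hx _ _
  obtain ⟨N, hN⟩ := H' (η m) (hη m) _ hD
    (by
      rintro _ ⟨i, rfl⟩
      exact ⟨v i, mem_range_self i, (huv i).trans_le (min_le_left _ _)⟩)
    (by
      rintro _ ⟨i, rfl⟩
      exact ⟨u i, mem_range_self i, by
        rw [dist_comm]
        exact (huv i).trans_le (min_le_left _ _)⟩)
  -- The index `Nat.pair m N` lies on level `m` and is at least `N`, and `κ` does not decrease it;
  -- so the pair found there admits no chain of length `N`.
  have h1 := hN _ (mem_range_self (Nat.pair m N)) _ (mem_range_self (Nat.pair m N))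
    ((huv _).trans_le (min_le_left _ _))
  simp only [hu, hv, Nat.unpair_pair, if_true] at h1
  exact hnot m _ (h1.of_le (hη m) ((Nat.right_le_pair m N).trans (hκ _)))

/-! ### Systems of traces -/

/-- A choice of traces between close points, with moduli that are uniform on bounded sets. -/
structure TraceSystem (X : Type u) [MetricSpace X] (o : X) where
  good : X → X → Prop
  dom : X → X → Set ℝ
  trace : X → X → ℝ → X
  exists_good : ∀ R : ℝ, ∃ ε > 0, ∀ x y, dist x o < R → dist y o < R → dist x y < ε → good x y
  zero_mem : ∀ x y, 0 ∈ dom x y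
  dist_mem : ∀ x y, dist x y ∈ dom x y
  dom_subset : ∀ x y, dom x y ⊆ Icc 0 (dist x y)
  subset_closure : ∀ x y, Icc 0 (dist x y) ⊆ closure (dom x y)
  trace_zero : ∀ x y, good x y → trace x y 0 = x
  trace_dist : ∀ x y, good x y → trace x y (dist x y) = y
  equicontinuous : ∀ R : ℝ, ∀ ε > 0, ∃ η > 0, ∀ x y, dist x o < R → dist y o < R → good x y →
    ∀ p ∈ dom x y, ∀ q ∈ dom x y, dist p q ≤ η → dist (trace x y p) (trace x y q) ≤ ε
  bounded : ∀ R : ℝ, ∃ C, ∀ x y, dist x o < R → dist y o < R → good x y →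
    ∀ p ∈ dom x y, ∀ q ∈ dom x y, dist (trace x y p) (trace x y q) ≤ C

/-- The rational points of `[0, d]` together with the end point `d`. -/
def ratDom (d : ℝ) : Set ℝ := insert d (Icc 0 d ∩ range ((↑) : ℚ → ℝ))

theorem ratDom_subset {d : ℝ} (hd : 0 ≤ d) : ratDom d ⊆ Icc 0 d :=
  insert_subset (right_mem_Icc.2 hd) inter_subset_left

theorem Icc_subset_closure_ratDom {d : ℝ} (hd : 0 ≤ d) : Icc 0 d ⊆ closure (ratDom d) := by
  rcases hd.eq_or_lt with rfl | hd
  · rw [Icc_self, singleton_subset_iff]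
    exact subset_closure (mem_insert _ _)
  · rw [← closure_Ioo hd.ne]
    refine closure_minimal ?_ isClosed_closure
    refine (Rat.denseRange_cast (𝕜 := ℝ)).open_subset_closure_inter isOpen_Ioo |>.trans ?_
    exact closure_mono ((inter_subset_inter_left _ Ioo_subset_Icc_self).trans (subset_insert _ _))

theorem dist_le_of_contModulus_le {Q : Set ℝ} {X : Type u} [MetricSpace X] {f : Q → X} {t c : ℝ}
    (hc : 0 ≤ c) (h : contModulus f t ≤ ENNReal.ofReal c) {p q : Q} (hpq : dist p q ≤ t) :
    dist (f p) (f q) ≤ c := by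
  rw [← edist_le_ofReal hc]
  refine le_trans ?_ h
  exact le_iSup_of_le p (le_iSup_of_le q (le_iSup_of_le hpq le_rfl))

/-- Each pair uses the data of the smallest closed ball of natural radius about `o` that contains
it. Points of a bounded region meet only finitely many such radii, so minima and sums of the
constants suffice. -/
theorem exists_traceSystem {X : Type u} [MetricSpace X] (o : X)
    (h : ∀ B : Set X, Bornology.IsBounded B → IsUnifLocTraceEquiConnectedAt X B) :
    Nonempty (TraceSystem X o) := by
  classical
  choose ε hε ω hω H using fun n : ℕ => h (Metric.closedBall o n) Metric.isBounded_closedBall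
  let N : X → X → ℕ := fun x y => ⌈max (dist x o) (dist y o)⌉₊
  have hex : ∀ x y, ∃ g : ℝ → X, dist x y < ε (N x y) → g 0 = x ∧ g (dist x y) = y ∧
      ∀ p ∈ ratDom (dist x y), ∀ q ∈ ratDom (dist x y), ∀ t > 0, dist p q ≤ t →
        dist (g p) (g q) ≤ ω (N x y) t := by
    intro x y
    by_cases hxy : dist x y < ε (N x y)
    · have hN : max (dist x o) (dist y o) ≤ N x y := Nat.le_ceil _
      obtain ⟨g, -, h0, h1, hg⟩ := H (N x y) x ((le_max_left _ _).trans hN) y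
        ((le_max_right _ _).trans hN) hxy (ratDom (dist x y))
        (((countable_range _).mono inter_subset_right).insert _) (ratDom_subset dist_nonneg)
        (Icc_subset_closure_ratDom dist_nonneg)
        (mem_insert_of_mem _ ⟨left_mem_Icc.2 dist_nonneg, 0, by simp⟩) (mem_insert _ _)
      refine ⟨fun t => if ht : t ∈ ratDom (dist x y) then g ⟨t, ht⟩ else x, fun _ => ⟨?_, ?_, ?_⟩⟩
      · simp only [h0, dite_eq_ite, ite_self]
      · simpa [ratDom] using h1
      · intro p hp q hq t ht hpq
        simp only [hp, hq, dif_pos]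
        exact dist_le_of_contModulus_le ((hω _).1 t ht).le (hg t ht) hpq
    · exact ⟨fun _ => x, fun h => absurd h hxy⟩
  choose g hg using hex
  have hNR : ∀ {R : ℝ} {x y : X}, dist x o < R → dist y o < R → N x y ∈ Iic ⌈R⌉₊ :=
    fun hx hy => Nat.ceil_mono (max_le hx.le hy.le)
  refine ⟨⟨fun x y => dist x y < ε (N x y), fun x y => ratDom (dist x y), g, fun R => ?_,
    fun x y => mem_insert_of_mem _ ⟨left_mem_Icc.2 dist_nonneg, 0, by simp⟩,
    fun x y => mem_insert _ _, fun x y => ratDom_subset dist_nonneg,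
    fun x y => Icc_subset_closure_ratDom dist_nonneg, fun x y h => (hg x y h).1,
    fun x y h => (hg x y h).2.1, fun R e he => ?_, fun R => ?_⟩⟩
  · have h1 : ∀ᶠ t in 𝓝[>] (0 : ℝ), ∀ n ∈ Iic ⌈R⌉₊, t < ε n :=
      (eventually_all_finite (finite_Iic _)).2 fun n _ =>
        mem_of_superset (Ioo_mem_nhdsGT (hε n)) fun t ht => ht.2
    obtain ⟨t, ht, ht0⟩ := (h1.and self_mem_nhdsWithin).exists
    exact ⟨t, ht0, fun x y hx hy hxy => hxy.trans (ht _ (hNR hx hy))⟩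
  · have h1 : ∀ᶠ t in 𝓝[>] (0 : ℝ), ∀ n ∈ Iic ⌈R⌉₊, ω n t < e :=
      (eventually_all_finite (finite_Iic _)).2 fun n _ => (hω n).2.2.eventually (gt_mem_nhds he)
    obtain ⟨t, ht, ht0⟩ := (h1.and self_mem_nhdsWithin).exists
    exact ⟨t, ht0, fun x y hx hy hxy p hp q hq hpq =>
      ((hg x y hxy).2.2 p hp q hq t ht0 hpq).trans (ht _ (hNR hx hy)).le⟩
  · refine ⟨∑ n ∈ Finset.range (⌈R⌉₊ + 1), ω n (ε n), fun x y hx hy hxy p hp q hq => ?_⟩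
    refine ((hg x y hxy).2.2 p hp q hq _ (hε _) ?_).trans
      (Finset.single_le_sum (f := fun n => ω n (ε n)) (fun n _ => ((hω n).1 _ (hε n)).le)
        (Finset.mem_range_succ_iff.2 (hNR hx hy)))
    have h1 := ratDom_subset dist_nonneg hp
    have h2 := ratDom_subset dist_nonneg hq
    exact (Real.dist_le_of_mem_Icc h1 h2).trans (by linarith)

/-! ### The neighbourhood retraction -/

/-- How much of the trace from `x ∈ A` to `y ∈ B` belongs to the set assigned to `z`. -/
noncomputable def traceWeight {X M : Type u} [MetricSpace X] [MetricSpace M] (i : Bd X → M) (z : M)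
    (A B : Bd X) (x y : X) : ℝ :=
  10 * min (2 * Metric.infDist z (range i) - dist z (i A))
    (min (4 * Metric.infDist z (range i) - dist z (i B))
      (5 * Metric.infDist z (range i) - dist x y))

theorem traceWeight_pos_iff {X M : Type u} [MetricSpace X] [MetricSpace M] {i : Bd X → M} {z : M}
    {A B : Bd X} {x y : X} : 0 < traceWeight i z A B x y ↔
      dist z (i A) < 2 * Metric.infDist z (range i) ∧
      dist z (i B) < 4 * Metric.infDist z (range i) ∧
      dist x y < 5 * Metric.infDist z (range i) := by
  simp [traceWeight]

theorem traceWeight_le_add {X M : Type u} [MetricSpace X] [MetricSpace M] (i : Bd X → M)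
    (z z' : M) (A B : Bd X) (x y : X) :
    traceWeight i z A B x y ≤ traceWeight i z' A B x y + 50 * dist z z' := by
  have h0 : Metric.infDist z (range i) ≤ Metric.infDist z' (range i) + dist z z' :=
    Metric.infDist_le_infDist_add_dist
  have h1 := dist_triangle_left z' (i A) z
  have h2 := dist_triangle_left z' (i B) z
  have h3 : (0 : ℝ) ≤ dist z z' := dist_nonneg
  have key : min (2 * Metric.infDist z (range i) - dist z (i A))
      (min (4 * Metric.infDist z (range i) - dist z (i B))
        (5 * Metric.infDist z (range i) - dist x y)) - 5 * dist z z' ≤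
      min (2 * Metric.infDist z' (range i) - dist z' (i A))
      (min (4 * Metric.infDist z' (range i) - dist z' (i B))
        (5 * Metric.infDist z' (range i) - dist x y)) := by
    refine le_min ?_ (le_min ?_ ?_)
    · have := min_le_left (2 * Metric.infDist z (range i) - dist z (i A))
        (min (4 * Metric.infDist z (range i) - dist z (i B))
          (5 * Metric.infDist z (range i) - dist x y))
      linarith
    · have := (min_le_right (2 * Metric.infDist z (range i) - dist z (i A))
        (min (4 * Metric.infDist z (range i) - dist z (i B))
          (5 * Metric.infDist z (range i) - dist x y))).trans (min_le_left _ _)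
      linarith
    · have := (min_le_right (2 * Metric.infDist z (range i) - dist z (i A))
        (min (4 * Metric.infDist z (range i) - dist z (i B))
          (5 * Metric.infDist z (range i) - dist x y))).trans (min_le_right _ _)
      linarith
  unfold traceWeight
  linarith

/-- The one-point set `{o}`. -/
def Bd.single {X : Type u} [MetricSpace X] (o : X) : Bd X :=
  ⟨{o}, singleton_nonempty o, isClosed_singleton, Bornology.isBounded_singleton⟩

theorem Isometry.exists_bd_dist_lt {X M : Type u} [MetricSpace X] [MetricSpace M] {i : Bd X → M}
    (hi : Isometry i) {z : M} {A B : Bd X} {r s : ℝ} (hA : dist z (i A) < r)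
    (hB : dist z (i B) < s) {x : X} (hx : x ∈ A.carrier) :
    ∃ y ∈ B.carrier, dist x y < r + s := by
  refine Bd.exists_dist_lt ?_ hx
  rw [← hi.dist_eq]
  have := dist_triangle_left (i A) (i B) z
  linarith

theorem Isometry.dist_lt_of_mem_bd {X M : Type u} [MetricSpace X] [MetricSpace M] {i : Bd X → M}
    (hi : Isometry i) (o : X) {z : M} {A : Bd X} {r s : ℝ} (hA : dist z (i A) < r)
    (hs : dist z (i (Bd.single o)) < s) {x : X} (hx : x ∈ A.carrier) : dist x o < r + s := by
  obtain ⟨y, hy, h⟩ := hi.exists_bd_dist_lt hA hs hx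
  rwa [mem_singleton_iff.1 hy] at h

namespace TraceSystem

variable {X M : Type u} [MetricSpace X] [MetricSpace M] {o : X}

/-- The union of the initial parts of traces that is assigned to `z`. -/
def traceSet (T : TraceSystem X o) (i : Bd X → M) (z : M) : Set X :=
  {w | ∃ (A B : Bd X) (x y : X), x ∈ A.carrier ∧ y ∈ B.carrier ∧
    ∃ q ∈ T.dom x y, q < traceWeight i z A B x y ∧ T.trace x y q = w}

/-- All the traces that are used at `z` exist. -/
def GoodAt (T : TraceSystem X o) (i : Bd X → M) (z : M) : Prop :=
  ∀ (A B : Bd X) (x y : X), x ∈ A.carrier → y ∈ B.carrier → 0 < traceWeight i z A B x y →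
    T.good x y

theorem pos_of_lt_traceWeight (T : TraceSystem X o) {i : Bd X → M} {z : M} {A B : Bd X} {x y : X}
    {q : ℝ} (hq : q ∈ T.dom x y) (h : q < traceWeight i z A B x y) :
    0 < traceWeight i z A B x y :=
  (T.dom_subset x y hq).1.trans_lt h

/-- A set within `3 / 2 * ρ` of `z` supplies a start `x'` with `dist x' x < 4 * ρ`. The minimum is
then at least `ρ / 2`, so the factor `10` keeps a part of length at least `5 * ρ`, which includes
the end `x`. The constant `5 / 2` exceeds the `2` required of starting sets, so that starting sets
at neighbouring points are covered too. -/
theorem mem_traceSet (T : TraceSystem X o) {i : Bd X → M} (hi : Isometry i) {z : M}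
    (hz : 0 < Metric.infDist z (range i)) (hg : T.GoodAt i z) {A : Bd X}
    (hA : dist z (i A) < 5 / 2 * Metric.infDist z (range i)) {x : X} (hx : x ∈ A.carrier) :
    x ∈ T.traceSet i z := by
  set ρ := Metric.infDist z (range i) with hρ
  obtain ⟨_, ⟨A', rfl⟩, hA'⟩ := (Metric.infDist_lt_iff (range_nonempty_iff_nonempty.2 ⟨A⟩)).1
    (show Metric.infDist z (range i) < 3 / 2 * ρ by linarith)
  obtain ⟨x', hx', hxx'⟩ := hi.exists_bd_dist_lt hA hA' hx
  rw [dist_comm] at hxx'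
  have hW : dist x' x < traceWeight i z A' A x' x := by
    have : ρ / 2 ≤ min (2 * ρ - dist z (i A')) (min (4 * ρ - dist z (i A)) (5 * ρ - dist x' x)) :=
      le_min (by linarith) (le_min (by linarith) (by linarith))
    rw [traceWeight, ← hρ]
    linarith
  exact ⟨A', A, x', x, hx', hx, _, T.dist_mem _ _, hW,
    T.trace_dist _ _ (hg _ _ _ _ hx' hx (dist_nonneg.trans_lt hW))⟩

/-- Every point used at `z` lies within this distance of the base point. -/
noncomputable def radius (i : Bd X → M) (o : X) (z : M) : ℝ :=
  4 * Metric.infDist z (range i) + (dist z (i (Bd.single o)) + 1)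

theorem radius_le {i : Bd X → M} {z z' : M} (h : dist z z' ≤ 1) :
    radius i o z ≤ radius i o z' + 5 := by
  have h0 : Metric.infDist z (range i) ≤ Metric.infDist z' (range i) + dist z z' :=
    Metric.infDist_le_infDist_add_dist
  have h1 := dist_triangle z z' (i (Bd.single o))
  unfold radius
  linarith

theorem dist_lt_radius {i : Bd X → M} (hi : Isometry i) {z : M} {A B : Bd X} {x y : X}
    (hx : x ∈ A.carrier) (hy : y ∈ B.carrier) (h : 0 < traceWeight i z A B x y) :
    dist x o < radius i o z ∧ dist y o < radius i o z := by
  obtain ⟨h1, h2, -⟩ := traceWeight_pos_iff.1 h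
  have h0 : 0 ≤ Metric.infDist z (range i) := Metric.infDist_nonneg
  exact ⟨hi.dist_lt_of_mem_bd o (h1.trans_le (by linarith)) (lt_add_one _) hx,
    hi.dist_lt_of_mem_bd o h2 (lt_add_one _) hy⟩

theorem isBounded_traceSet (T : TraceSystem X o) {i : Bd X → M} (hi : Isometry i) {z : M}
    (hg : T.GoodAt i z) : Bornology.IsBounded (T.traceSet i z) := by
  obtain ⟨C, hC⟩ := T.bounded (radius i o z)
  refine (Metric.isBounded_closedBall (x := o) (r := C + radius i o z)).subset ?_
  rintro _ ⟨A, B, x, y, hx, hy, q, hq, hqW, rfl⟩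
  have hW := T.pos_of_lt_traceWeight hq hqW
  have hgood := hg A B x y hx hy hW
  obtain ⟨hxo, hyo⟩ := dist_lt_radius (o := o) hi hx hy hW
  have h1 := hC x y hxo hyo hgood q hq 0 (T.zero_mem x y)
  rw [T.trace_zero x y hgood] at h1
  have h2 := dist_triangle (T.trace x y q) x o
  rw [Metric.mem_closedBall]
  linarith

/-- The weight changes by at most `50 * dist z z' ≤ η / 2`, so a trace is shortened only slightly.
If it vanishes altogether at `z'`, the part used at `z` was short and its start still belongs to the
set at `z'`. -/
theorem exists_mem_traceSet_dist_le (T : TraceSystem X o) {i : Bd X → M} (hi : Isometry i)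
    {z z' : M} (hg : T.GoodAt i z) (hg' : T.GoodAt i z')
    (hz' : 6 * dist z z' < Metric.infDist z' (range i)) {ε η R : ℝ} (hR : radius i o z ≤ R)
    (hη : ∀ x y, dist x o < R → dist y o < R → T.good x y →
      ∀ p ∈ T.dom x y, ∀ q ∈ T.dom x y, dist p q ≤ η → dist (T.trace x y p) (T.trace x y q) ≤ ε)
    (hε : 0 ≤ ε) (hzη : 100 * dist z z' ≤ η) {w : X} (hw : w ∈ T.traceSet i z) :
    ∃ w' ∈ T.traceSet i z', dist w w' ≤ ε := by
  obtain ⟨A, B, x, y, hx, hy, q, hq, hqW, rfl⟩ := hw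
  have hW := T.pos_of_lt_traceWeight hq hqW
  have hgood := hg A B x y hx hy hW
  obtain ⟨hxo, hyo⟩ := dist_lt_radius (o := o) hi hx hy hW
  have hmod := hη x y (hxo.trans_le hR) (hyo.trans_le hR) hgood
  have hWW := traceWeight_le_add i z z' A B x y
  have hq01 := T.dom_subset x y hq
  rcases lt_or_ge q (traceWeight i z' A B x y) with hlt | hge
  · exact ⟨_, ⟨A, B, x, y, hx, hy, q, hq, hlt, rfl⟩, by simpa using hε⟩
  · rcases lt_or_ge 0 (traceWeight i z' A B x y) with hpos | hneg
    · have hlt : max 0 (traceWeight i z' A B x y - η / 2) < traceWeight i z' A B x y :=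
        max_lt hpos (by linarith)
      obtain ⟨t, ht1, ht2⟩ := exists_between hlt
      have ht : t ∈ closure (T.dom x y) := T.subset_closure x y
        ⟨(le_max_left _ _).trans ht1.le, ht2.le.trans (hge.trans hq01.2)⟩
      obtain ⟨q', hq', hqd⟩ := mem_closure_iff.1 ht _ isOpen_Ioo ⟨ht1, ht2⟩
      refine ⟨_, ⟨A, B, x, y, hx, hy, q', hqd, hq'.2, rfl⟩, hmod _ hq _ hqd ?_⟩
      have h1 := (le_max_right _ _).trans_lt hq'.1
      have h2 := hq'.2
      rw [Real.dist_eq, abs_le]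
      constructor <;> linarith
    · refine ⟨x, T.mem_traceSet hi ((by positivity : 0 ≤ 6 * dist z z').trans_lt hz') hg'
        (A := A) ?_ hx, ?_⟩
      · have h1 := (traceWeight_pos_iff.1 hW).1
        have h2 := dist_triangle_left z' (i A) z
        have h0 : Metric.infDist z (range i) ≤ Metric.infDist z' (range i) + dist z z' :=
          Metric.infDist_le_infDist_add_dist
        linarith
      · have h1 := hmod _ hq _ (T.zero_mem x y)
        rw [T.trace_zero x y hgood] at h1
        refine h1 ?_
        rw [Real.dist_eq, abs_le]
        constructor <;> linarith [hq01.1]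

theorem mem_interior_goodAt (T : TraceSystem X o) {i : Bd X → M} (hi : Isometry i) (A₀ : Bd X) :
    i A₀ ∈ interior {z | T.GoodAt i z} := by
  obtain ⟨ε, hε, H⟩ := T.exists_good (radius i o (i A₀) + 5)
  rw [mem_interior_iff_mem_nhds]
  refine Metric.mem_nhds_iff.2 ⟨min 1 (ε / 5), by positivity, fun z hz A B x y hx hy hW => ?_⟩
  have hz1 : dist z (i A₀) < 1 := hz.trans_le (min_le_left _ _)
  have hz2 : dist z (i A₀) < ε / 5 := hz.trans_le (min_le_right _ _)
  obtain ⟨hxo, hyo⟩ := dist_lt_radius (o := o) hi hx hy hW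
  have hr := radius_le (o := o) (i := i) hz1.le
  refine H x y (hxo.trans_le hr) (hyo.trans_le hr) ?_
  have h1 := (traceWeight_pos_iff.1 hW).2.2
  have h2 : Metric.infDist z (range i) ≤ dist z (i A₀) :=
    Metric.infDist_le_dist_of_mem (mem_range_self A₀)
  linarith

/-- The values of the retraction. -/
theorem exists_retract (T : TraceSystem X o) {i : Bd X → M} (hi : Isometry i)
    (hc : IsClosed (range i)) {z : M} (hz : T.GoodAt i z) :
    ∃ D : Bd X, (z ∉ range i → D.carrier = closure (T.traceSet i z)) ∧ ∀ A, i A = z → D = A := by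
  by_cases h : z ∈ range i
  · obtain ⟨A, rfl⟩ := h
    exact ⟨A, fun h => absurd (mem_range_self A) h, fun B hB => (hi.injective hB).symm⟩
  · have hne : (range i).Nonempty := ⟨_, mem_range_self (Bd.single o)⟩
    have hρ := (hc.notMem_iff_infDist_pos hne).1 h
    obtain ⟨_, ⟨A, rfl⟩, hA⟩ := (Metric.infDist_lt_iff hne).1
      (show Metric.infDist z (range i) < 5 / 2 * Metric.infDist z (range i) by linarith)
    obtain ⟨x, hx⟩ := A.nonempty
    refine ⟨⟨closure (T.traceSet i z), ⟨x, _root_.subset_closure (T.mem_traceSet hi hρ hz hA hx)⟩,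
      isClosed_closure, (T.isBounded_traceSet hi hz).closure⟩, fun _ => rfl, fun B hB => ?_⟩
    exact absurd ⟨B, hB⟩ h

end TraceSystem

theorem Bd.dist_le_of_closure {X : Type u} [MetricSpace X] {A B : Bd X} {S T : Set X}
    (hA : A.carrier = closure S) (hB : B.carrier = closure T) {r : ℝ} (hr : 0 ≤ r)
    (h₁ : ∀ x ∈ S, ∃ y ∈ T, dist x y ≤ r) (h₂ : ∀ x ∈ T, ∃ y ∈ S, dist x y ≤ r) :
    dist A B ≤ r := by
  change Metric.hausdorffDist A.carrier B.carrier ≤ r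
  rw [hA, hB, Metric.hausdorffDist_closure]
  exact Metric.hausdorffDist_le_of_mem_dist hr h₁ h₂

/-- Near a point `i A₀` all kept parts are short and start near `A₀`, while some set near `A₀` is
contained entirely in the union. Off the image, continuity is the slow variation of the weights. -/
theorem TraceSystem.isANR {X : Type u} [MetricSpace X] {o : X} (T : TraceSystem X o) :
    IsANR (Bd X) := by
  intro M _ i hi hc
  have hUg : ∀ z : interior {z | T.GoodAt i z}, T.GoodAt i z := fun z => interior_subset z.2
  choose r hr hr' using fun z : interior {z | T.GoodAt i z} => T.exists_retract hi hc (hUg z)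
  refine ⟨_, isOpen_interior, range_subset_iff.2 (T.mem_interior_goodAt hi), r, ?_,
    fun A => hr' _ A rfl⟩
  have hne : (range i).Nonempty := ⟨_, mem_range_self (Bd.single o)⟩
  rw [Metric.continuous_iff]
  intro z₀ ε hε
  by_cases hz₀ : (z₀ : M) ∈ range i
  · obtain ⟨A₀, hA₀⟩ := hz₀
    obtain ⟨η, hη, hmod⟩ := T.equicontinuous (radius i o (i A₀) + 5) (ε / 4) (by positivity)
    -- Parameters are at most `dist x y`, which is below five times the distance from `z` to the
    -- image; hence `η / 5`. The bound `ε / 20` controls the starting points.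
    refine ⟨min 1 (min (η / 5) (ε / 20)), by positivity, fun z hz => ?_⟩
    rw [hr' z₀ A₀ hA₀]
    rw [Subtype.dist_eq, ← hA₀] at hz
    have hz1 : dist (z : M) (i A₀) < 1 := hz.trans_le (min_le_left _ _)
    have hz2 : dist (z : M) (i A₀) < η / 5 :=
      hz.trans_le ((min_le_right _ _).trans (min_le_left _ _))
    have hz3 : dist (z : M) (i A₀) < ε / 20 :=
      hz.trans_le ((min_le_right _ _).trans (min_le_right _ _))
    by_cases hzi : (z : M) ∈ range i
    · obtain ⟨A, hA⟩ := hzi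
      rw [hr' z A hA, ← hi.dist_eq, hA]
      linarith
    · have hρ := (hc.notMem_iff_infDist_pos hne).1 hzi
      have hρ' : Metric.infDist (z : M) (range i) ≤ dist (z : M) (i A₀) :=
        Metric.infDist_le_dist_of_mem (mem_range_self A₀)
      refine (Bd.dist_le_of_closure (hr z hzi) A₀.isClosed.closure_eq.symm (r := ε / 2)
        (by positivity) ?_ fun a ha => ?_).trans_lt (by linarith)
      · rintro _ ⟨A, B, x, y, hx, hy, q, hq, hqW, rfl⟩
        have hW := T.pos_of_lt_traceWeight hq hqW
        have hgood := hUg z A B x y hx hy hW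
        obtain ⟨hxo, hyo⟩ := dist_lt_radius (o := o) hi hx hy hW
        have hrad := radius_le (o := o) (i := i) hz1.le
        obtain ⟨hW1, -, hW3⟩ := traceWeight_pos_iff.1 hW
        have h1 := hmod x y (hxo.trans_le hrad) (hyo.trans_le hrad) hgood q hq 0 (T.zero_mem x y)
        rw [T.trace_zero x y hgood] at h1
        have hq01 := T.dom_subset x y hq
        have h2 := h1 (by rw [Real.dist_eq, abs_le]; constructor <;> linarith [hq01.1, hq01.2])
        obtain ⟨a, ha, hxa⟩ := hi.exists_bd_dist_lt hW1 hz3 hx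
        refine ⟨a, ha, (dist_triangle _ x a).trans ?_⟩
        linarith
      · obtain ⟨_, ⟨A, rfl⟩, hA⟩ := (Metric.infDist_lt_iff hne).1
          (show Metric.infDist (z : M) (range i) < 5 / 2 * Metric.infDist (z : M) (range i) by
            linarith)
        obtain ⟨x, hx, hax⟩ := hi.exists_bd_dist_lt hz3 hA ha
        exact ⟨x, T.mem_traceSet hi hρ (hUg z) hA hx, by linarith⟩
  · have hρ := (hc.notMem_iff_infDist_pos hne).1 hz₀
    set ρ := Metric.infDist (z₀ : M) (range i) with hρdef
    obtain ⟨η, hη, hmod⟩ := T.equicontinuous (radius i o (z₀ : M) + 5) (ε / 2) (by positivity)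
    -- The distance of `z` from the image is still at least `19 / 20 * ρ`, so the comparison works
    -- in both directions.
    refine ⟨min 1 (min (η / 100) (ρ / 20)), by positivity, fun z hz => ?_⟩
    rw [Subtype.dist_eq] at hz
    have hz1 : dist (z : M) z₀ < 1 := hz.trans_le (min_le_left _ _)
    have hz2 : dist (z : M) z₀ < η / 100 :=
      hz.trans_le ((min_le_right _ _).trans (min_le_left _ _))
    have hz3 : dist (z : M) z₀ < ρ / 20 :=
      hz.trans_le ((min_le_right _ _).trans (min_le_right _ _))
    have hρz : ρ ≤ Metric.infDist (z : M) (range i) + dist (z₀ : M) z :=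
      Metric.infDist_le_infDist_add_dist
    have hcomm := dist_comm (z₀ : M) z
    have hzi : (z : M) ∉ range i := (hc.notMem_iff_infDist_pos hne).2 (by linarith)
    refine (Bd.dist_le_of_closure (hr z hzi) (hr z₀ hz₀) (r := ε / 2) (by positivity)
      (fun w hw => ?_) fun w hw => ?_).trans_lt (by linarith)
    · exact T.exists_mem_traceSet_dist_le hi (hUg z) (hUg z₀) (by linarith)
        (radius_le (o := o) (i := i) hz1.le) hmod (by positivity) (by linarith) hw
    · exact T.exists_mem_traceSet_dist_le hi (hUg z₀) (hUg z) (by linarith)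
        (by linarith) hmod (by positivity) (by linarith) hw

theorem isANR_bd_of_isUnifLocTraceEquiConnectedAt {X : Type u} [MetricSpace X]
    (h : ∀ B : Set X, Bornology.IsBounded B → IsUnifLocTraceEquiConnectedAt X B) :
    IsANR (Bd X) := by
  rcases isEmpty_or_nonempty X with hX | ⟨⟨o⟩⟩
  · intro M _ i hi hc
    have hE : IsEmpty (Bd X) := ⟨fun A => hX.false A.nonempty.some⟩
    exact ⟨∅, isOpen_empty, range_subset_iff.2 hE.elim, fun z => z.2.elim,
      continuous_of_const fun z => z.2.elim, fun A => hE.elim A⟩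
  · exact (exists_traceSystem o h).some.isANR

/-! ### Lipschitz maps from countable sets into dense sets -/

/-- Two points of the graph of a function that is strictly `L`-Lipschitz. -/
def LipCompat (L : ℝ) (z w : ℝ × ℝ) : Prop :=
  z = w ∨ |z.2 - w.2| < L * |z.1 - w.1|

theorem LipCompat.symm {L : ℝ} {z w : ℝ × ℝ} (h : LipCompat L z w) : LipCompat L w z := by
  rcases h with rfl | h
  · exact Or.inl rfl
  · right
    rwa [abs_sub_comm, abs_sub_comm w.1]

/-- Strictness of the Lipschitz condition leaves a nonempty open interval of admissible values,
which meets the dense set. -/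
theorem exists_lipCompat_insert {L : ℝ} (hL : 0 < L) {P : Set ℝ} (hP : Dense P)
    {F : Finset (ℝ × ℝ)} (hne : F.Nonempty) (hF : ∀ z ∈ F, ∀ w ∈ F, LipCompat L z w)
    (hFP : ∀ z ∈ F, z.2 ∈ P) (q : ℝ) : ∃ a ∈ P, ∀ z ∈ F, LipCompat L z (q, a) := by
  by_cases hq : ∃ z ∈ F, z.1 = q
  · obtain ⟨z, hz, rfl⟩ := hq
    exact ⟨z.2, hFP z hz, fun w hw => hF w hw z hz⟩
  · push Not at hq
    have hpos : ∀ z ∈ F, 0 < L * |z.1 - q| := fun z hz =>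
      mul_pos hL (abs_pos.2 (sub_ne_zero.2 (hq z hz)))
    have hlt : F.sup' hne (fun z => z.2 - L * |z.1 - q|) <
        F.inf' hne (fun z => z.2 + L * |z.1 - q|) := by
      rw [Finset.sup'_lt_iff]
      intro z hz
      rw [Finset.lt_inf'_iff]
      intro w hw
      rcases hF z hz w hw with rfl | h
      · linarith [hpos z hz]
      · have h1 := le_abs_self (z.2 - w.2)
        have h2 := mul_le_mul_of_nonneg_left (abs_sub_le z.1 q w.1) hL.le
        rw [mul_add, abs_sub_comm q] at h2
        linarith
    obtain ⟨a, ha, ha1, ha2⟩ := hP.exists_between hlt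
    refine ⟨a, ha, fun z hz => Or.inr ?_⟩
    have h1 := (Finset.sup'_lt_iff hne).1 ha1 z hz
    have h2 := (Finset.lt_inf'_iff hne).1 ha2 z hz
    rw [abs_lt]
    constructor <;> dsimp only <;> linarith

/-- Finite partial functions are extended point by point along an enumeration of `Q`. The slope from
`(0, 0)` to `(d, 1)` is `1 / d`; the constant `2 / d` leaves the strict room needed at the start. -/
theorem exists_lipschitz_into_dense {P Q : Set ℝ} (hP : Dense P) (hP0 : (0 : ℝ) ∈ P)
    (hP1 : (1 : ℝ) ∈ P) (hQ : Q.Countable) {d : ℝ} (hd : 0 < d) (h0 : (0 : ℝ) ∈ Q) (h1 : d ∈ Q) :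
    ∃ φ : ℝ → ℝ, φ 0 = 0 ∧ φ d = 1 ∧ (∀ q ∈ Q, φ q ∈ P) ∧
      ∀ p ∈ Q, ∀ q ∈ Q, |φ p - φ q| ≤ 2 / d * |p - q| := by
  classical
  have hL : 0 < 2 / d := by positivity
  obtain ⟨e, rfl⟩ := hQ.exists_eq_range ⟨0, h0⟩
  let G := {F : Finset (ℝ × ℝ) // F.Nonempty ∧ (∀ z ∈ F, ∀ w ∈ F, LipCompat (2 / d) z w) ∧
    ∀ z ∈ F, z.2 ∈ P}
  have hstep : ∀ (F : G) (n : ℕ), ∃ F' : G, F.1 ⊆ F'.1 ∧ ∃ a, (e n, a) ∈ F'.1 := by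
    rintro ⟨F, hne, hF, hFP⟩ n
    obtain ⟨a, ha, hFa⟩ := exists_lipCompat_insert hL hP hne hF hFP (e n)
    refine ⟨⟨insert (e n, a) F, Finset.insert_nonempty _ _, ?_, ?_⟩, Finset.subset_insert _ _, a,
      Finset.mem_insert_self _ _⟩
    · intro z hz w hw
      rcases Finset.mem_insert.1 hz with rfl | hz <;> rcases Finset.mem_insert.1 hw with rfl | hw
      · exact Or.inl rfl
      · exact (hFa w hw).symm
      · exact hFa z hz
      · exact hF z hz w hw
    · intro z hz
      rcases Finset.mem_insert.1 hz with rfl | hz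
      · exact ha
      · exact hFP z hz
  choose step hsub hmem using hstep
  have hcompat : LipCompat (2 / d) (0, 0) (d, 1) := by
    right
    simp only [zero_sub, abs_neg, abs_one, abs_of_pos hd]
    rw [div_mul_cancel₀ _ hd.ne']
    norm_num
  let F₀ : G := ⟨{(0, 0), (d, 1)}, by simp, by
    intro z hz w hw
    simp only [Finset.mem_insert, Finset.mem_singleton] at hz hw
    rcases hz with rfl | rfl <;> rcases hw with rfl | rfl
    · exact Or.inl rfl
    · exact hcompat
    · exact hcompat.symm
    · exact Or.inl rfl, by
    intro z hz
    simp only [Finset.mem_insert, Finset.mem_singleton] at hz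
    rcases hz with rfl | rfl
    · exact hP0
    · exact hP1⟩
  let F : ℕ → G := fun n => Nat.rec F₀ (fun n F => step F n) n
  have hmono : Monotone fun n => (F n).1 := monotone_nat_of_le_succ fun n => hsub _ _
  have hall : ∀ z w, (∃ n, z ∈ (F n).1) → (∃ n, w ∈ (F n).1) → LipCompat (2 / d) z w := by
    rintro z w ⟨n, hn⟩ ⟨m, hm⟩
    exact (F (max n m)).2.2.1 z (hmono (le_max_left n m) hn) w (hmono (le_max_right n m) hm)
  have hfun : ∀ q a b, (∃ n, (q, a) ∈ (F n).1) → (∃ n, (q, b) ∈ (F n).1) → a = b := by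
    intro q a b ha hb
    rcases hall _ _ ha hb with h | h
    · exact (Prod.ext_iff.1 h).2
    · simp only [sub_self, abs_zero, mul_zero] at h
      exact absurd h (not_lt.2 (abs_nonneg _))
  have hex : ∀ q, ∃ a, q ∈ range e → ∃ n, (q, a) ∈ (F n).1 := by
    intro q
    by_cases hq : q ∈ range e
    · obtain ⟨n, rfl⟩ := hq
      obtain ⟨a, ha⟩ := hmem (F n) n
      exact ⟨a, fun _ => ⟨n + 1, ha⟩⟩
    · exact ⟨0, fun h => absurd h hq⟩
  choose φ hφ using hex
  refine ⟨φ, hfun 0 _ _ (hφ 0 h0) ⟨0, by simp [F, F₀]⟩, hfun d _ _ (hφ d h1) ⟨0, by simp [F, F₀]⟩,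
    fun q hq => ?_, fun p hp q hq => ?_⟩
  · obtain ⟨n, hn⟩ := hφ q hq
    exact (F n).2.2.2 _ hn
  · rcases hall _ _ (hφ p hp) (hφ q hq) with h | h
    · obtain ⟨h1, h2⟩ := Prod.ext_iff.1 h
      dsimp only at h1 h2
      simp [h1]
    · exact h.le

/-! ### Moduli of continuity -/

/-- The infimum of all bounds available at `t` is monotone and tends to zero; the summand `t` makes
it positive. -/
theorem exists_isContModulus {s : ℕ → ℝ} (hs : ∀ m, 0 < s m) (C : ℝ) (hC : 0 < C) :
    ∃ ω, IsContModulus ω ∧ ∀ t > 0, ∀ D, D ≤ C → (∀ m, t ≤ s m → D ≤ C * (1 / 2) ^ m) →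
      D ≤ ω t := by
  let T : ℝ → Set ℝ := fun t => insert C {c | ∃ m, t ≤ s m ∧ c = C * (1 / 2) ^ m}
  have hne : ∀ t, (T t).Nonempty := fun t => insert_nonempty _ _
  have hnn : ∀ t, ∀ c ∈ T t, 0 ≤ c := by
    rintro t c (rfl | ⟨m, -, rfl⟩)
    · exact hC.le
    · positivity
  have hbdd : ∀ t, BddBelow (T t) := fun t => ⟨0, hnn t⟩
  have h0 : ∀ t, 0 ≤ sInf (T t) := fun t => le_csInf (hne t) (hnn t)
  refine ⟨fun t => t + sInf (T t), ⟨fun t ht => add_pos_of_pos_of_nonneg ht (h0 t), ?_, ?_⟩, ?_⟩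
  · intro t _ t' _ htt'
    refine add_le_add htt' (csInf_le_csInf (hbdd t) (hne t') ?_)
    rintro c (rfl | ⟨m, hm, rfl⟩)
    · exact mem_insert _ _
    · exact mem_insert_of_mem _ ⟨m, htt'.trans hm, rfl⟩
  · rw [Metric.tendsto_nhds]
    intro ε hε
    obtain ⟨m, hm⟩ := exists_pow_lt_of_lt_one (show 0 < ε / (2 * C) by positivity)
      (show (1 / 2 : ℝ) < 1 by norm_num)
    filter_upwards [Ioo_mem_nhdsGT (lt_min (hs m) (half_pos hε))] with t ht
    have h1 : sInf (T t) ≤ C * (1 / 2) ^ m :=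
      csInf_le (hbdd t) (mem_insert_of_mem _ ⟨m, (ht.2.trans_le (min_le_left _ _)).le, rfl⟩)
    have h2 := ht.2.trans_le (min_le_right _ _)
    have h3 : C * (1 / 2) ^ m < ε / 2 := by
      have := mul_lt_mul_of_pos_left hm hC
      rwa [show C * (ε / (2 * C)) = ε / 2 by field_simp] at this
    rw [Real.dist_0_eq_abs, abs_of_nonneg (add_nonneg ht.1.le (h0 t))]
    linarith
  · intro t ht D hD h
    have : D ≤ sInf (T t) := by
      refine le_csInf (hne t) ?_
      rintro c (rfl | ⟨m, hm, rfl⟩)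
      · exact hD
      · exact h m hm
    dsimp only
    linarith

theorem IsContModulus.uniformContinuous_and_le {A B : Type*} [MetricSpace A] [MetricSpace B]
    {ω : ℝ → ℝ} (hω : IsContModulus ω) {f : A → B}
    (h : ∀ t > 0, ∀ a b, dist a b ≤ t → dist (f a) (f b) ≤ ω t) :
    UniformContinuous f ∧ ∀ t, 0 < t → contModulus f t ≤ ENNReal.ofReal (ω t) := by
  constructor
  · rw [Metric.uniformContinuous_iff]
    intro ε hε
    obtain ⟨t, ht, ht0⟩ := ((hω.2.2.eventually (gt_mem_nhds hε)).and self_mem_nhdsWithin).exists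
    exact ⟨t, ht0, fun a b hab => (h t ht0 _ _ hab.le).trans_lt ht⟩
  · intro t ht
    refine iSup_le fun a => iSup_le fun b => iSup_le fun hab => ?_
    rw [edist_dist]
    exact ENNReal.ofReal_le_ofReal (h t ht a b hab)

/-! ### Successive refinement of chains -/

/-- Functions on successively finer grids; the cells of the `j`-th grid are divided into
`N (n + j)` parts. -/
structure GridSystem (X : Type u) [MetricSpace X] (δ : ℕ → ℝ) (N : ℕ → ℕ) (n : ℕ) (x y : X) where
  val : ℕ → ℕ → X
  val_zero : val 0 0 = x
  val_succ : ∀ k, val 0 (k + 1) = y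
  val_mul : ∀ j k, val (j + 1) (N (n + j) * k) = val j k
  dist_succ : ∀ j k, dist (val j k) (val j (k + 1)) < δ (n + j)
  dist_refine : ∀ j k, dist (val (j + 1) k) (val j (k / N (n + j))) < (1 / 2) ^ (n + j)

theorem exists_gridSystem {X : Type u} [MetricSpace X] {B : Set X} {δ : ℕ → ℝ} {N : ℕ → ℕ}
    (hδ : ∀ m, 0 < δ m) (hN : ∀ m, 2 ≤ N m)
    (H : ∀ m, ∀ x ∈ Metric.thickening 2 B, ∀ y ∈ Metric.thickening 2 B, dist x y < δ m →
      Linked (δ (m + 1)) (Metric.ball x ((1 / 2) ^ m)) (N m) x y)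
    (n : ℕ) {x y : X} (hx : x ∈ B) (hy : y ∈ B) (hxy : dist x y < δ n) :
    Nonempty (GridSystem X δ N n x y) := by
  have hex : ∀ (m : ℕ) (x y : X), ∃ c : ℕ → X, x ∈ Metric.thickening 2 B →
      y ∈ Metric.thickening 2 B → dist x y < δ m → c 0 = x ∧ c (N m) = y ∧
        (∀ i ≤ N m, c i ∈ Metric.ball x ((1 / 2) ^ m)) ∧
        ∀ i < N m, dist (c i) (c (i + 1)) < δ (m + 1) := by
    intro m x y
    by_cases h : x ∈ Metric.thickening 2 B ∧ y ∈ Metric.thickening 2 B ∧ dist x y < δ m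
    · obtain ⟨c, hc⟩ := H m x h.1 y h.2.1 h.2.2
      exact ⟨c, fun _ _ _ => hc⟩
    · exact ⟨fun _ => x, fun h1 h2 h3 => absurd ⟨h1, h2, h3⟩ h⟩
  choose c hc using hex
  -- Row `0` equals `y` at every index after `0`, so every cell of every row has two ends and `k`
  -- needs no upper bound.
  let a : ℕ → ℕ → X := fun j => Nat.rec (fun k => if k = 0 then x else y)
    (fun j f k => c (n + j) (f (k / N (n + j))) (f (k / N (n + j) + 1)) (k % N (n + j))) j
  have ha : ∀ j k, a (j + 1) k = c (n + j) (a j (k / N (n + j))) (a j (k / N (n + j) + 1))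
    (k % N (n + j)) := fun j k => rfl
  have hNpos : ∀ m, 0 < N m := fun m => by linarith [hN m]
  have hthick : ∀ {j : ℕ} {w b : X}, b ∈ B → dist w b ≤ 2 - 2 * (1 / 2) ^ j →
      w ∈ Metric.thickening 2 B := fun {j w b} hb h => Metric.mem_thickening_iff.2 ⟨b, hb, by
    have : (0 : ℝ) < (1 / 2) ^ j := by positivity
    linarith⟩
  -- Refining row `i` moves points by less than `(1 / 2) ^ i`; the total `2 - 2 * (1 / 2) ^ j` keeps
  -- row `j` in the `2`-thickening, where chains are available.
  have key : ∀ j, (∀ k, ∃ b ∈ B, dist (a j k) b ≤ 2 - 2 * (1 / 2) ^ j) ∧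
      ∀ k, dist (a j k) (a j (k + 1)) < δ (n + j) := by
    intro j
    induction j with
    | zero =>
      refine ⟨fun k => ⟨a 0 k, ?_, by simp⟩, fun k => ?_⟩
      · change (if k = 0 then x else y) ∈ B
        split_ifs <;> assumption
      · change dist (if k = 0 then x else y) (if k + 1 = 0 then x else y) < δ (n + 0)
        by_cases hk : k = 0
        · simpa [hk] using hxy
        · simpa [hk] using hδ n
    | succ j ih =>
      have hmem : ∀ k, a j k ∈ Metric.thickening 2 B := fun k =>
        let ⟨b, hb, h⟩ := ih.1 k
        hthick hb h
      have hcj := fun k => hc (n + j) _ _ (hmem k) (hmem (k + 1)) (ih.2 k)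
      refine ⟨fun k => ?_, fun k => ?_⟩
      · obtain ⟨b, hb, h⟩ := ih.1 (k / N (n + j))
        refine ⟨b, hb, ?_⟩
        have h1 := (hcj (k / N (n + j))).2.2.1 _ (Nat.mod_lt k (hNpos (n + j))).le
        rw [← ha, Metric.mem_ball] at h1
        have h2 : (1 / 2 : ℝ) ^ (n + j) ≤ (1 / 2) ^ j :=
          pow_le_pow_of_le_one (by norm_num) (by norm_num) (Nat.le_add_left _ _)
        have h3 := dist_triangle (a (j + 1) k) (a j (k / N (n + j))) b
        rw [pow_succ]
        linarith
      · have hlt := Nat.mod_lt k (hNpos (n + j))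
        have hdm := Nat.div_add_mod k (N (n + j))
        have hstep := (hcj (k / N (n + j))).2.2.2 _ hlt
        rw [← ha] at hstep
        rcases Nat.lt_or_ge (k % N (n + j) + 1) (N (n + j)) with h | h
        · have h1 : (k + 1) / N (n + j) = k / N (n + j) := by
            rw [Nat.div_eq_iff (hNpos _)]
            rw [mul_comm] at hdm
            constructor <;> omega
          have h2 : (k + 1) % N (n + j) = k % N (n + j) + 1 := by
            rw [Nat.add_mod_of_add_mod_lt, Nat.mod_eq_of_lt (hN (n + j))]
            rwa [Nat.mod_eq_of_lt (hN (n + j))]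
          rwa [ha j (k + 1), h1, h2]
        -- At the end of a cell the next point is the start of the following cell, which is also the
        -- last point of the current chain.
        · have h0 : k % N (n + j) + 1 = N (n + j) := le_antisymm hlt h
          have hk : k + 1 = N (n + j) * (k / N (n + j) + 1) := by
            rw [mul_add, mul_one]
            omega
          rw [ha j (k + 1), hk, Nat.mul_div_cancel_left _ (hNpos _), Nat.mul_mod_right,
            (hcj _).1, ← (hcj (k / N (n + j))).2.1]
          rw [h0] at hstep
          exact hstep
  have hmem : ∀ j k, a j k ∈ Metric.thickening 2 B := fun j k =>
    let ⟨b, hb, h⟩ := (key j).1 k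
    hthick hb h
  have hcj := fun j k => hc (n + j) _ _ (hmem j k) (hmem j (k + 1)) ((key j).2 k)
  refine ⟨⟨a, rfl, fun k => rfl, fun j k => ?_, fun j => (key j).2, fun j k => ?_⟩⟩
  · rw [ha, Nat.mul_div_cancel_left _ (hNpos _), Nat.mul_mod_right, (hcj _ _).1]
  · exact (hcj j (k / N (n + j))).2.2.1 _ (Nat.mod_lt k (hNpos (n + j))).le

namespace GridSystem

variable {X : Type u} [MetricSpace X] {δ : ℕ → ℝ} {N : ℕ → ℕ} {n : ℕ} {x y : X}

/-- The number of cells of the `j`-th grid in the unit interval. -/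
def cells (N : ℕ → ℕ) (n j : ℕ) : ℕ := ∏ i ∈ Finset.range j, N (n + i)

theorem cells_succ (j : ℕ) : cells N n (j + 1) = cells N n j * N (n + j) :=
  Finset.prod_range_succ _ _

theorem cells_pos (hN : ∀ m, 2 ≤ N m) (j : ℕ) : 0 < cells N n j :=
  Finset.prod_pos fun i _ => by linarith [hN (n + i)]

theorem two_pow_le_cells (hN : ∀ m, 2 ≤ N m) (j : ℕ) : 2 ^ j ≤ cells N n j := by
  induction j with
  | zero => simp [cells]
  | succ j ih =>
    rw [cells_succ, pow_succ]
    exact Nat.mul_le_mul ih (hN _)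

theorem cells_le (hN : ∀ m, 2 ≤ N m) (j : ℕ) :
    cells N n j ≤ ∏ i ∈ Finset.range (n + j), N i := by
  rw [Finset.prod_range_add]
  exact Nat.le_mul_of_pos_left _ (Finset.prod_pos fun i _ => by linarith [hN i])

/-- The step function that takes the value of the grid point to the left. -/
noncomputable def step (G : GridSystem X δ N n x y) (j : ℕ) (p : ℝ) : X :=
  G.val j ⌊p * cells N n j⌋₊

/-- The grids are nested: dividing the finer floor by the number of parts gives the coarser floor.
-/
theorem dist_step_succ (G : GridSystem X δ N n x y) (hN : ∀ m, 2 ≤ N m) (j : ℕ) (p : ℝ) :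
    dist (G.step (j + 1) p) (G.step j p) < (1 / 2) ^ (n + j) := by
  have h := G.dist_refine j ⌊p * cells N n (j + 1)⌋₊
  have hN0 : (N (n + j) : ℝ) ≠ 0 := Nat.cast_ne_zero.2 (by linarith [hN (n + j)])
  rwa [← Nat.floor_div_natCast, cells_succ, Nat.cast_mul, ← mul_assoc,
    mul_div_cancel_right₀ _ hN0, mul_assoc, ← Nat.cast_mul, ← cells_succ] at h

theorem dist_step_le (G : GridSystem X δ N n x y) (hN : ∀ m, 2 ≤ N m) (j l : ℕ) (p : ℝ) :
    dist (G.step (j + l) p) (G.step j p) ≤ 2 * (1 / 2) ^ (n + j) - 2 * (1 / 2) ^ (n + j + l) := by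
  induction l with
  | zero => simp
  | succ l ih =>
    have h1 := G.dist_step_succ hN (j + l) p
    have h2 := dist_triangle (G.step (j + l + 1) p) (G.step (j + l) p) (G.step j p)
    rw [← add_assoc] at h1 ⊢
    rw [← add_assoc, pow_succ]
    linarith

theorem dist_step_step_lt (G : GridSystem X δ N n x y) (hN : ∀ m, 2 ≤ N m) (hδ : ∀ m, 0 < δ m)
    {j : ℕ} {p q : ℝ} (hpq : |p - q| ≤ 1 / cells N n j) :
    dist (G.step j p) (G.step j q) < δ (n + j) := by
  wlog h : p ≤ q generalizing p q
  · rw [dist_comm]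
    exact this (by rwa [abs_sub_comm]) (le_of_not_ge h)
  have hM : (0 : ℝ) < cells N n j := Nat.cast_pos.2 (cells_pos hN j)
  rw [abs_sub_comm, abs_of_nonneg (sub_nonneg.2 h), le_div_iff₀ hM] at hpq
  have h1 : ⌊p * cells N n j⌋₊ ≤ ⌊q * cells N n j⌋₊ := Nat.floor_mono (by gcongr)
  have h2 : ⌊q * cells N n j⌋₊ ≤ ⌊p * cells N n j⌋₊ + 1 := by
    refine Nat.le_of_lt_succ ?_
    rw [Nat.floor_lt' (by omega)]
    have := Nat.lt_floor_add_one (p * cells N n j)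
    push_cast
    nlinarith
  unfold step
  rcases Nat.le_and_le_add_one_iff.1 ⟨h1, h2⟩ with h | h
  · rw [h, dist_self]
    exact hδ _
  · rw [h]
    exact G.dist_succ _ _

theorem dist_step_zero_lt (G : GridSystem X δ N n x y) (hδ : ∀ m, 0 < δ m) (p q : ℝ) :
    dist (G.step 0 p) (G.step 0 q) < δ n := by
  have hxy : dist x y < δ n := by simpa [G.val_zero, G.val_succ] using G.dist_succ 0 0
  have hval : ∀ k, G.val 0 k = x ∨ G.val 0 k = y := fun k => by
    cases k with
    | zero => exact Or.inl G.val_zero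
    | succ k => exact Or.inr (G.val_succ k)
  unfold step
  rcases hval ⌊p * cells N n 0⌋₊ with h | h <;> rcases hval ⌊q * cells N n 0⌋₊ with h' | h' <;>
    rw [h, h']
  · simpa using hδ n
  · exact hxy
  · rwa [dist_comm]
  · simpa using hδ n

theorem step_grid (G : GridSystem X δ N n x y) (hN : ∀ m, 2 ≤ N m) (J k l : ℕ) :
    G.step (J + l) (k / cells N n J) = G.val J k := by
  have hint : ∀ l, ∃ m : ℕ, (k / cells N n J * cells N n (J + l) : ℝ) = m ∧
      G.val (J + l) m = G.val J k := by
    intro l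
    induction l with
    | zero =>
      have : (cells N n J : ℝ) ≠ 0 := Nat.cast_ne_zero.2 (cells_pos hN J).ne'
      exact ⟨k, by rw [add_zero, div_mul_cancel₀ _ this], rfl⟩
    | succ l ih =>
      obtain ⟨m, hm, hv⟩ := ih
      refine ⟨N (n + (J + l)) * m, ?_, ?_⟩
      · rw [← add_assoc, cells_succ, Nat.cast_mul, ← mul_assoc, hm, Nat.cast_mul, mul_comm]
      · rw [← add_assoc, G.val_mul, hv]
  obtain ⟨m, hm, hv⟩ := hint l
  rw [step, hm, Nat.floor_natCast, hv]

/-- The real numbers at which the step functions are eventually constant. -/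
def stable (G : GridSystem X δ N n x y) : Set ℝ :=
  {p | ∃ J, ∀ j ≥ J, G.step j p = G.step J p}

theorem grid_mem_stable (G : GridSystem X δ N n x y) (hN : ∀ m, 2 ≤ N m) (J k : ℕ) :
    (k / cells N n J : ℝ) ∈ G.stable := by
  refine ⟨J, fun j hj => ?_⟩
  obtain ⟨l, rfl⟩ := Nat.exists_eq_add_of_le hj
  rw [G.step_grid hN, ← G.step_grid hN J k 0, add_zero]

theorem dense_stable (G : GridSystem X δ N n x y) (hN : ∀ m, 2 ≤ N m) : Dense G.stable := by
  refine dense_of_exists_between fun a b hab => ?_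
  rcases lt_or_ge a 0 with ha | ha
  · obtain ⟨c, hac, hcb⟩ := exists_between (lt_min hab ha)
    -- The natural floor of a negative number is `0`, so every step function takes the value `x`
    -- there.
    refine ⟨c, ⟨0, fun j _ => ?_⟩, hac, hcb.trans_le (min_le_left _ _)⟩
    have hc : ∀ j, ⌊c * cells N n j⌋₊ = 0 := fun j => Nat.floor_of_nonpos <|
      mul_nonpos_of_nonpos_of_nonneg (hcb.trans_le (min_le_right _ _)).le (Nat.cast_nonneg _)
    have hv : ∀ j, G.val j 0 = G.val 0 0 := fun j => by
      induction j with
      | zero => rfl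
      | succ j ih => rw [← ih, ← G.val_mul j 0, mul_zero]
    rw [step, step, hc, hc, hv]
  · obtain ⟨J, hJ⟩ := exists_pow_lt_of_lt_one (sub_pos.2 hab) (show (1 / 2 : ℝ) < 1 by norm_num)
    have hM : (0 : ℝ) < cells N n J := Nat.cast_pos.2 (cells_pos hN J)
    have hMJ : 1 < (b - a) * cells N n J := by
      have h1 : (2 : ℝ) ^ J ≤ cells N n J := by exact_mod_cast two_pow_le_cells (n := n) hN J
      have h2 : (1 / 2 : ℝ) ^ J * 2 ^ J = 1 := by rw [← mul_pow]; norm_num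
      have h3 : (0 : ℝ) < 2 ^ J := by positivity
      nlinarith [mul_lt_mul_of_pos_right hJ h3]
    refine ⟨_, G.grid_mem_stable hN J (⌊a * cells N n J⌋₊ + 1), ?_, ?_⟩
    · rw [lt_div_iff₀ hM]
      exact_mod_cast Nat.lt_floor_add_one _
    · rw [div_lt_iff₀ hM]
      have := Nat.floor_le (mul_nonneg ha hM.le)
      push_cast
      linarith

/-- The limit of the step functions. -/
theorem exists_limit (G : GridSystem X δ N n x y) (hN : ∀ m, 2 ≤ N m) (hδ : ∀ m, 0 < δ m)
    (hδ' : ∀ m, δ m ≤ (1 / 2) ^ m) : ∃ g : ℝ → X, g 0 = x ∧ g 1 = y ∧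
      (∀ p ∈ G.stable, ∀ q ∈ G.stable, dist (g p) (g q) ≤ 5 * (1 / 2) ^ n) ∧
      ∀ j, ∀ p ∈ G.stable, ∀ q ∈ G.stable, |p - q| ≤ 1 / cells N n j →
        dist (g p) (g q) ≤ 5 * (1 / 2) ^ (n + j) := by
  have hex : ∀ p, ∃ w, p ∈ G.stable → ∃ J, ∀ j ≥ J, G.step j p = w := by
    intro p
    by_cases hp : p ∈ G.stable
    · obtain ⟨J, hJ⟩ := hp
      exact ⟨_, fun _ => ⟨J, hJ⟩⟩
    · exact ⟨x, fun h => absurd h hp⟩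
  choose g hg using hex
  have hgrid : ∀ k : ℕ, g (k / cells N n 0) = G.val 0 k := by
    intro k
    obtain ⟨J, hJ⟩ := hg _ (G.grid_mem_stable hN 0 k)
    rw [← hJ (0 + J) (by simp), G.step_grid hN]
  have hclose : ∀ p ∈ G.stable, ∀ j, dist (g p) (G.step j p) ≤ 2 * (1 / 2) ^ (n + j) := by
    intro p hp j
    obtain ⟨J, hJ⟩ := hg p hp
    rw [← hJ (j + J) (by simp)]
    refine (G.dist_step_le hN j J p).trans ?_
    have : (0 : ℝ) < (1 / 2) ^ (n + j + J) := by positivity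
    linarith
  -- The constant `5` is twice the tail bound `2` plus `1` for a step of the grid.
  have htri : ∀ j, ∀ p ∈ G.stable, ∀ q ∈ G.stable,
      dist (G.step j p) (G.step j q) < δ (n + j) → dist (g p) (g q) ≤ 5 * (1 / 2) ^ (n + j) := by
    intro j p hp q hq h
    have h1 := dist_triangle4 (g p) (G.step j p) (G.step j q) (g q)
    have h2 := hclose p hp j
    have h3 := hclose q hq j
    rw [dist_comm] at h3
    linarith [hδ' (n + j)]
  refine ⟨g, ?_, ?_, fun p hp q hq => ?_, fun j p hp q hq hpq => ?_⟩
  · simpa [G.val_zero] using hgrid 0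
  · simpa [G.val_succ 0, cells] using hgrid 1
  · simpa using htri 0 p hp q hq (by simpa using G.dist_step_zero_lt hδ p q)
  · exact htri j p hp q hq (G.dist_step_step_lt hN hδ hpq)

end GridSystem

theorem exists_antitone_scale {δ' : ℕ → ℝ} (h : ∀ m, 0 < δ' m) :
    ∃ δ : ℕ → ℝ, (∀ m, 0 < δ m) ∧ Antitone δ ∧ (∀ m, δ m ≤ δ' m) ∧ ∀ m, δ m ≤ (1 / 2) ^ m := by
  let c : ℕ → ℝ := fun m => min (δ' m) ((1 / 2) ^ m)
  have hc : ∀ m, 0 < c m := fun m => lt_min (h m) (by positivity)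
  let δ : ℕ → ℝ := fun m => Nat.rec (c 0) (fun m d => min d (c (m + 1))) m
  have hle : ∀ m, δ m ≤ c m := fun m => by
    cases m with
    | zero => exact le_rfl
    | succ m => exact min_le_right _ _
  refine ⟨δ, fun m => ?_, antitone_nat_of_succ_le fun m => min_le_left _ _,
    fun m => (hle m).trans (min_le_left _ _), fun m => (hle m).trans (min_le_right _ _)⟩
  induction m with
  | zero => exact hc 0
  | succ m ih => exact lt_min ih (hc _)

theorem isUnifLocTraceEquiConnectedAt_of_thickening {X : Type u} [MetricSpace X] {B : Set X}
    (h : IsUnifLocChainEquiConnectedAt X (Metric.thickening 2 B)) :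
    IsUnifLocTraceEquiConnectedAt X B := by
  rw [isUnifLocChainEquiConnectedAt_iff] at h
  choose δ' hδ' H using fun m : ℕ => h ((1 / 2) ^ m) (by positivity)
  obtain ⟨δ, hδ, hanti, hle, hhalf⟩ := exists_antitone_scale hδ'
  choose N₀ hN₀ using fun m => H m (δ (m + 1)) (hδ _)
  set N : ℕ → ℕ := fun m => N₀ m + 2 with hNdef
  have hN : ∀ m, 2 ≤ N m := fun m => Nat.le_add_left _ _
  have hL : ∀ m, ∀ x ∈ Metric.thickening 2 B, ∀ y ∈ Metric.thickening 2 B, dist x y < δ m →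
      Linked (δ (m + 1)) (Metric.ball x ((1 / 2) ^ m)) (N m) x y := fun m x hx y hy hxy =>
    (hN₀ m x hx y hy (hxy.trans_le (hle m))).of_le (hδ _) (Nat.le_add_right _ _)
  set K : ℕ → ℝ := fun m => ((∏ i ∈ Finset.range m, N i : ℕ) : ℝ) with hK
  have hKpos : ∀ m, 0 < K m := fun m =>
    Nat.cast_pos.2 (Finset.prod_pos fun i _ => by linarith [hN i])
  -- For `m ≥ n`, the slope `2 / d` with `d ≥ δ (n + 1) ≥ δ (m + 1)` turns `t ≤ δ (m + 1) / (2 * K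
  -- m)` into parameters at most `1 / K m` apart, no more than one cell of the grid. The modulus
  -- does not depend on the pair.
  obtain ⟨ω, hω, hωD⟩ := exists_isContModulus (s := fun m => δ (m + 1) / (2 * K m))
    (fun m => div_pos (hδ _) (by linarith [hKpos m])) 5 (by norm_num)
  refine ⟨δ 0, hδ 0, ω, hω, fun x hx y hy hxy Q hQ hQI _ h0 h1 => ?_⟩
  rcases (dist_nonneg (x := x) (y := y)).eq_or_lt with hd | hd
  · have hxy' : x = y := dist_eq_zero.1 hd.symm
    obtain ⟨hu, hm⟩ := hω.uniformContinuous_and_le (f := fun _ : Q => x) fun t ht _ _ _ => by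
      simpa using (hω.1 t ht).le
    exact ⟨_, hu, rfl, hxy', hm⟩
  -- Refinement begins at the scale that matches `dist x y`: the upper bound admits the first chain,
  -- the lower one controls the slope `2 / d`.
  · obtain ⟨n, hn1, hn2⟩ : ∃ n, δ (n + 1) ≤ dist x y ∧ dist x y < δ n := by
      classical
      have hex : ∃ n, δ n ≤ dist x y := by
        obtain ⟨m, hm⟩ := exists_pow_lt_of_lt_one hd (show (1 / 2 : ℝ) < 1 by norm_num)
        exact ⟨m, (hhalf m).trans hm.le⟩
      have hne : Nat.find hex ≠ 0 := fun h => by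
        have := Nat.find_spec hex
        rw [h] at this
        linarith
      obtain ⟨n, hn⟩ := Nat.exists_eq_succ_of_ne_zero hne
      exact ⟨n, (congrArg δ hn).symm.trans_le (Nat.find_spec hex),
        not_le.1 (Nat.find_min hex (by omega))⟩
    obtain ⟨G⟩ := exists_gridSystem hδ hN hL n hx hy hn2
    obtain ⟨g, hg0, hg1, hgb, hgm⟩ := G.exists_limit hN hδ hhalf
    have hs0 : (0 : ℝ) ∈ G.stable := by simpa using G.grid_mem_stable hN 0 0
    have hs1 : (1 : ℝ) ∈ G.stable := by
      simpa [GridSystem.cells] using G.grid_mem_stable hN 0 1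
    -- `Q` is prescribed, whereas `g` is controlled only at stable parameters, so `Q` is moved into
    -- these.
    obtain ⟨φ, hφ0, hφ1, hφs, hφL⟩ :=
      exists_lipschitz_into_dense (G.dense_stable hN) hs0 hs1 hQ hd h0 h1
    obtain ⟨hu, hm⟩ := hω.uniformContinuous_and_le (f := fun q : Q => g (φ q)) fun t ht p q hpq => by
      have hp := hφs p p.2
      have hq := hφs q q.2
      have hb := hgb _ hp _ hq
      refine hωD t ht _ (hb.trans ?_) fun m hm => ?_
      · have : (1 / 2 : ℝ) ^ n ≤ 1 := pow_le_one₀ (by norm_num) (by norm_num)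
        linarith
      · rcases le_total m n with hmn | hnm
        · refine hb.trans ?_
          have : (1 / 2 : ℝ) ^ n ≤ (1 / 2) ^ m :=
            pow_le_pow_of_le_one (by norm_num) (by norm_num) hmn
          linarith
        · obtain ⟨j, rfl⟩ := Nat.exists_eq_add_of_le hnm
          refine hgm j _ hp _ hq ((hφL p p.2 q q.2).trans ?_)
          have hM : (0 : ℝ) < GridSystem.cells N n j :=
            Nat.cast_pos.2 (GridSystem.cells_pos hN j)
          have hMK : (GridSystem.cells N n j : ℝ) ≤ K (n + j) :=
            Nat.cast_le.2 (GridSystem.cells_le hN j)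
          have hδd : δ (n + j + 1) ≤ dist x y := (hanti (by omega)).trans hn1
          rw [Subtype.dist_eq, Real.dist_eq] at hpq
          rw [le_div_iff₀ (by linarith [hKpos (n + j)])] at hm
          rw [le_div_iff₀ hM, div_mul_eq_mul_div, div_mul_eq_mul_div, div_le_one hd]
          have h2 : |(p : ℝ) - q| * GridSystem.cells N n j ≤ t * K (n + j) :=
            mul_le_mul hpq hMK hM.le ht.le
          linarith
    exact ⟨_, hu, by simp [hφ0, hg0], by simp [hφ1, hg1], hm⟩

/-! ### The cycle of implications -/

theorem mainTheorem4 (X : Type u) [MetricSpace X] :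
    List.TFAE
      [ IsANR (Bd X),
        LocallyPathConnectedSpace (Bd X),
        IsLocallyChainConnected (Bd X),
        IsLocallyChainConnectedAt (Bd X) {A : Bd X | A.carrier ∈ discreteZero X},
        ∀ B : Set X, Bornology.IsBounded B → IsUnifLocChainEquiConnectedAt X B,
        ∀ B : Set X, Bornology.IsBounded B → IsUnifLocTraceEquiConnectedAt X B ] := by
  tfae_have 1 → 2 := IsANR.locallyPathConnectedSpace
  tfae_have 2 → 3 := fun _ => LocallyPathConnectedSpace.isLocallyChainConnected
  tfae_have 3 → 4 := IsLocallyChainConnectedAt.mono (subset_univ _)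
  tfae_have 4 → 5 := fun h _ hB => h.chainsAtTestSets.isUnifLocChainEquiConnectedAt hB
  tfae_have 5 → 6 := fun h _ hB => isUnifLocTraceEquiConnectedAt_of_thickening (h _ hB.thickening)
  tfae_have 6 → 1 := isANR_bd_of_isUnifLocTraceEquiConnectedAt
  tfae_finish
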